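/- **Definitions.** Let $n\ge 2$. A Gelfand–Tsetlin (GT) triangle of size $n$ is an array $X=(x_{i,j})_{n\ge i\ge j\ge1}$ of positive integers with $x_{i+1,j}\le x_{i,j}\le x_{i+1,j+1}$ whenever these entries are defined. It is a *Gog triangle* if $x_{i,j}<x_{i,j+1}$ for $1\le j<i\le n-1$ and $x_{n,j}=j$ for $1\le j\le n$; it is a *Magog triangle* if $x_{i,i}\le i$ for $1\le i\le n$. For $k\le n-1$ let $s_kX$ be obtained from $X$ by replacing each entry $x_{k,j}$ of row $k$ by $\max(x_{k+1,j},x_{k-1,j-1})+\min(x_{k+1,j+1},x_{k-1,j})-x_{k,j}$, where undefined entries are omitted from the max and the min. Put $\omega_j=s_js_{j-1}\cdots s_1$ and $S=\omega_1\omega_2\cdots\omega_{n-1}$ (the Schützenberger involution). A *GOGAm triangle* is a GT triangle $X$ such that $SX$ is a Magog triangle. An $(n,2)$ Gog trapezoid is a Gog triangle of size $n$ with $x_{i,j}=j$ for $i-j\ge2$; an $(n,2)$ Magog (GOGAm) trapezoid is a Magog (GOGAm) triangle of size $n$ with $x_{i,j}=1$ for $i-j\ge2$. If $M$ is an alternating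 sign matrix (ASM) of size $n$, its Gog triangle has as its $i$-th row $x_{i,1}<\dots<x_{i,i}$ the columns $c$ with $\sum_{p\ge n-i+1}M_{p,c}=1$. For $1\le k\le n$ and integers $u_0,\dots,u_{k-1}$, $v_1,\dots,v_{k-1}$ let $T_{k}(u,v)$ be the triangular array of size $k$ with $x_{k-t,k-t}=u_t$, $x_{k-t+1,k-t}=v_t$ and all other entries equal to $n-k+1$. Call $(u,v)$ *$k$-admissible* if $T_k(u,v)$ is a GT triangle, $u_0\le n$, $u_0-u_i+v_i\le n-1$ for $1\le i\le k-1$, and $u_0-u_i+v_i-v_j+1\le j-1$ for $1\le i<j\le k-1$. **Direct algorithm.** Let $X$ be an $(n,2)$ Gog trapezoid, $a_t=x_{n-t,n-t}$, $b_t=x_{n-t+1,n-t}$. Start with $X^{(1)}=T_1(u)$, $u_0=n$. For $k=1,\dots,n-1$, given $X^{(k)}=T_k(u,v)$, put $u_k=a_k$, $v_k=b_k$, and define $X^{(k+1)}=T_{k+1}(u',v')$ as follows, with $u'_k=u_k$ always. - (i) If $v_k=u_k=n-k$: $u'_i=u_i-1$, $v'_i=v_i-1$ for $i\le k-1$, and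 $v'_k=v_k$. - (ii) If $v_k=n-k<u_k$: $u'_i=u_i$, $v'_i=v_i-1$ for $i\le k-1$, and $v'_k=v_k$. - (iii) If $n-k<v_k=u_k$: $u'_i=u_i-1$ for $i\le k-1$, and - (iiia) if $v'_i=v_i$ $(i\le k)$ makes $T_{k+1}(u',v')$ a GT triangle, this is the choice of $v'$; - (iiib) otherwise $v'_i=v_i-1$ for $i\le k-1$ and $v'_k=n-k$. - (iv) If $n-k<v_k<u_k$: $u'_i=u_i$ for all $i$, and - (iva) if $v_k\le v_{k-1}$, then $v'_i=v_i$ for all $i$; - (ivb) if $v_k>v_{k-1}$, let $l=\max\{i : 0\le i\le k-1,\ v_{k-i}\le v_k-i\}$; then $v'_i=n-k$ for $k-l+1\le i\le k$, $v'_{k-l}=v_k-l$, and $v'_i=v_i$ for $i<k-l$. Let $\Phi(X)=X^{(n)}$. **Inverse algorithm.** Let $X$ be an $(n,2)$ GOGAm trapezoid and $X^{(n)}=X$. For $k=n-1,\dots,1$, given $X^{(k+1)}=T_{k+1}(u',v')$, define $u_0,\dots,u_k$, $v_1,\dots,v_k$ as follows (indices $i$ of entries $v_i$ being at least 1). When $v'_k=n-k$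 put $l=1+\max\{j : 0\le j\le k-1,\ v'_{k-j}=n-k\}$. - (i) If $n-k=v'_k=u'_k$: $u_i=u'_i+1$, $v_i=v'_i+1$ for $i\le k-1$; $v_k=v'_k$, $u_k=u'_k$. - (ii) If $n-k=v'_k<u'_k$ and $v'_i<u'_i$ for all $1\le i<k$: $u_i=u'_i$, $v_i=v'_i+1$ for $i\le k-1$; $v_k=v'_k$, $u_k=u'_k$. - (iiia) If $n-k<v'_k=u'_k$: $u_i=u'_i+1$, $v_i=v'_i$ for $i\le k-1$; $v_k=v'_k$, $u_k=u'_k$. - (iiib) If $n-k=v'_k<u'_k$, $u'_i=v'_i$ for some $1\le i<k$, and $v'_{k-l}+l\ge u'_k$: $u_i=u'_i+1$, $v_i=v'_i+1$ for $i\le k-1$; $v_k=u_k=u'_k$. - (iva) If $n-k<v'_k<u'_k$: $u_i=u'_i$, $v_i=v'_i$ for $i\le k$. - (ivb) If $n-k=v'_k<u'_k$, $u'_i=v'_i$ for some $1\le i<k$, and $v'_{k-l}+l<u'_k$: $u_i=u'_i$ for $i\le k$, $v_i=n-k+1$ for $k-l\le i\le k-1$, $v_k=v'_{k-l}+l$,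 and $v_i=v'_i$ for all other $i$. Record $a_k=u_k$, $b_k=v_k$, and let $X^{(k)}=T_k(u,v)$ (with the entries of index $<k$). Finally let $a_0$ be the single entry of $X^{(1)}$, and let $\Psi(X)$ be the array of size $n$ with $x_{n-t,n-t}=a_t$, $x_{n-t+1,n-t}=b_t$ and $x_{i,j}=j$ for $i-j\ge2$. **Theorem.** Let $n\ge2$. 1. For every $(n,2)$ Gog trapezoid and every $1\le k\le n$, the triangle $X^{(k)}$ of the direct algorithm is $k$-admissible and has $u_{k-1}=a_{k-1}$. For every $(n,2)$ GOGAm trapezoid and every $1\le k\le n$, the triangle $X^{(k)}$ of the inverse algorithm is $k$-admissible. 2. $\Phi$ maps $(n,2)$ Gog trapezoids to $(n,2)$ GOGAm trapezoids, $\Psi$ maps $(n,2)$ GOGAm trapezoids to $(n,2)$ Gog trapezoids, and $\Phi$ and $\Psi$ are mutually inverse bijections. 3. $S\circ\Phi$ is a bijection from the $(n,2)$ Gog trapezoids to the $(n,2)$ Magog trapezoids. 4. Consequently, composing with the map from ASMs to Gog triangles, $\Phi$ and $S\circ\Phi$ give bijections from the set of ASMs of size $n$ whose Gog triangle is an $(n,2)$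 Gog trapezoid to the sets of $(n,2)$ GOGAm trapezoids and of $(n,2)$ Magog trapezoids, respectively. -/

import Mathlib

/-- A triangular array `X = (x_{i,j})`, `n ≥ i ≥ j ≥ 1`, of integers, as a function of the two
one-based indices; `IsGelfandTsetlin` requires the value `0` outside the index range, so that
equality of functions is equality of arrays. -/
abbrev TriArray := ℕ → ℕ → ℤ

/-- `X` is a Gelfand-Tsetlin triangle of size `n`. -/
structure IsGelfandTsetlin (n : ℕ) (X : TriArray) : Prop where
  pos : ∀ i j, 1 ≤ j → j ≤ i → i ≤ n → 0 < X i j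
  zero : ∀ i j, ¬ (1 ≤ j ∧ j ≤ i ∧ i ≤ n) → X i j = 0
  left : ∀ i j, 1 ≤ j → j ≤ i → i + 1 ≤ n → X (i + 1) j ≤ X i j
  right : ∀ i j, 1 ≤ j → j ≤ i → i + 1 ≤ n → X i j ≤ X (i + 1) (j + 1)

/-- Gog triangles of size `n`. -/
structure IsGog (n : ℕ) (X : TriArray) : Prop where
  gt : IsGelfandTsetlin n X
  strict : ∀ i j, 1 ≤ j → j < i → i ≤ n - 1 → X i j < X i (j + 1)
  top : ∀ j, 1 ≤ j → j ≤ n → X n j = j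

/-- Magog triangles of size `n`. -/
structure IsMagog (n : ℕ) (X : TriArray) : Prop where
  gt : IsGelfandTsetlin n X
  diag : ∀ i, 1 ≤ i → i ≤ n → X i i ≤ i

/-- The set of `(n, k)` Gog trapezoids. -/
def gogTrapezoids (n k : ℕ) : Set TriArray :=
  {X | IsGog n X ∧ ∀ i j, 1 ≤ j → j ≤ i → i ≤ n → j + k ≤ i → X i j = j}

/-- The set of `(n, k)` Magog trapezoids. -/
def magogTrapezoids (n k : ℕ) : Set TriArray :=
  {X | IsMagog n X ∧ ∀ i j, 1 ≤ j → j ≤ i → i ≤ n → j + k ≤ i → X i j = 1}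

/-! ### The Schützenberger involution -/

/-- The operator `s_k` on triangles (of any size larger than `k`): the entry `x_{k,j}` is reflected
in the interval `[max(x_{k+1,j}, x_{k-1,j-1}), min(x_{k+1,j+1}, x_{k-1,j})]`, where `x_{k-1,j-1}`
is left out for `j = 1` and `x_{k-1,j}` is left out for `j = k`. -/
def sOp (k : ℕ) (X : TriArray) : TriArray := fun i j =>
  if i = k ∧ 1 ≤ j ∧ j ≤ k then
    (if j = 1 then X (k + 1) j else max (X (k + 1) j) (X (k - 1) (j - 1)))
      + (if j = k then X (k + 1) (j + 1) else min (X (k + 1) (j + 1)) (X (k - 1) j))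
      - X k j
  else X i j

/-- `ω_j = s_j s_{j-1} ⋯ s_1` (composition of operators). -/
def omegaOp : ℕ → TriArray → TriArray
  | 0 => id
  | j + 1 => sOp (j + 1) ∘ omegaOp j

/-- `ω_1 ω_2 ⋯ ω_m` (composition of operators). -/
def omegaProd : ℕ → TriArray → TriArray
  | 0 => id
  | m + 1 => omegaProd m ∘ omegaOp (m + 1)

/-- The Schützenberger involution `S = ω_1 ω_2 ⋯ ω_{n-1}` on triangles of size `n`. -/
def schutzenberger (n : ℕ) : TriArray → TriArray := omegaProd (n - 1)

/-- GOGAm triangles of size `n`. -/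
structure IsGogam (n : ℕ) (X : TriArray) : Prop where
  gt : IsGelfandTsetlin n X
  magog : IsMagog n (schutzenberger n X)

/-- The set of `(n, k)` GOGAm trapezoids. -/
def gogamTrapezoids (n k : ℕ) : Set TriArray :=
  {X | IsGogam n X ∧ ∀ i j, 1 ≤ j → j ≤ i → i ≤ n → j + k ≤ i → X i j = 1}

/-! ### Alternating sign matrices -/

/-- The nonzero terms of the finite sequence `f` alternate in sign. -/
def AlternatesInSign {n : ℕ} (f : Fin n → ℤ) : Prop :=
  ∀ p q, p < q → f p ≠ 0 → f q ≠ 0 → (∀ r, p < r → r < q → f r = 0) → f p * f q < 0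

/-- Alternating sign matrices of size `n`. -/
structure IsASM {n : ℕ} (M : Matrix (Fin n) (Fin n) ℤ) : Prop where
  entries : ∀ p q, M p q = -1 ∨ M p q = 0 ∨ M p q = 1
  row_sum : ∀ p, ∑ q, M p q = 1
  col_sum : ∀ q, ∑ p, M p q = 1
  row_alt : ∀ p, AlternatesInSign (fun q => M p q)
  col_alt : ∀ q, AlternatesInSign (fun p => M p q)

/-- `c` (one-based) is a column in which row `n - i + 1` (one-based, that is row `n - i` of the
zero-based index type `Fin n`) of the matrix of column sums `M̃_{r c} = ∑_{p ≥ r} M_{p c}` has the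
entry `1`. -/
def IsOneColumn {n : ℕ} (M : Matrix (Fin n) (Fin n) ℤ) (i c : ℕ) : Prop :=
  ∃ q : Fin n, (q : ℕ) + 1 = c ∧ ∑ p : Fin n, (if n - i ≤ (p : ℕ) then M p q else 0) = 1

/-- The Gog triangle of an alternating sign matrix: `x_{i,j}` is the `j`-th smallest column with an
entry `1` in row `n - i + 1` of `M̃`. -/
noncomputable def gogOfASM (n : ℕ) (M : Matrix (Fin n) (Fin n) ℤ) : TriArray := fun i j =>
  if 1 ≤ j ∧ j ≤ i ∧ i ≤ n then (Nat.nth (IsOneColumn M i) (j - 1) : ℤ) else 0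

/-- Alternating sign matrices of size `n` whose Gog triangle is an `(n, k)` Gog trapezoid. -/
def asmTrapezoids (n k : ℕ) : Set (Matrix (Fin n) (Fin n) ℤ) :=
  {M | IsASM M ∧ gogOfASM n M ∈ gogTrapezoids n k}

/-! ### Trapezoids with two free diagonals -/

/-- The entries of the two rightmost SW-NE diagonals, read from the top: in a triangle of size `m`,
`u t = x_{m-t,m-t}` for `0 ≤ t ≤ m - 1` and `v t = x_{m-t+1,m-t}` for `1 ≤ t ≤ m - 1`. -/
@[ext] structure TwoDiag where
  u : ℕ → ℤ
  v : ℕ → ℤ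

/-- The triangle of size `m` with two rightmost SW-NE diagonals `D` and all other entries of the
`j`-th NW-SE diagonal equal to `c j`. Entries of `D` beyond the size are ignored. -/
def triangleOf (m : ℕ) (c : ℕ → ℤ) (D : TwoDiag) : TriArray := fun i j =>
  if 1 ≤ j ∧ j ≤ i ∧ i ≤ m then
    if i = j then D.u (m - i) else if i = j + 1 then D.v (m - j) else c j
  else 0

/-- The two rightmost SW-NE diagonals of a triangle of size `n`. -/
def twoDiagOf (n : ℕ) (X : TriArray) : TwoDiag where
  u := fun t => X (n - t) (n - t)
  v := fun t => X (n - t + 1) (n - t)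

/-- Properties of the intermediate triangles `X^(k)` of the algorithms: the triangle of size `k`
with two free diagonals `D` and all other entries `n - k + 1` is a Gelfand-Tsetlin triangle, and
three families of inequalities hold. -/
structure IsAdmissible (n k : ℕ) (D : TwoDiag) : Prop where
  gt : IsGelfandTsetlin k (triangleOf k (fun _ => (n : ℤ) - k + 1) D)
  ineq_zero : D.u 0 ≤ n
  ineq_one : ∀ i, 1 ≤ i → i ≤ k - 1 → D.u 0 - D.u i + D.v i ≤ n - 1
  ineq_two : ∀ i j, 1 ≤ i → i < j → j ≤ k - 1 → D.u 0 - D.u i + D.v i - D.v j + 1 ≤ (j : ℤ) - 1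

/-! ### The algorithm from Gog to GOGAm trapezoids -/

/-- The `l` of rule (ivb): `max {i | v_{k-i} ≤ v_k - i}`, with `0 ≤ i ≤ k - 1`. -/
def forwardL (k : ℕ) (v : ℕ → ℤ) : ℕ :=
  Nat.findGreatest (fun i => v (k - i) ≤ v k - (i : ℤ)) (k - 1)

open scoped Classical in
/-- One step of the algorithm. `D` holds the two free diagonals `u_0, …, u_{k-1}` and
`v_1, …, v_{k-1}` of `X^(k)`; the new NW-SE diagonal `n-k, …, n-k, v_k = b, u_k = a` is added on its
left and the result `Z^(k)` is modified to `X^(k+1)`. In the order of the code, the rules are (i),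
(ii), (iiia), (iiib), (iva), (ivb). They are applied with `n - k ≤ v_k ≤ u_k`, so the omitted
conditions (such as `v_k < u_k` for the second rule) are automatic. -/
noncomputable def forwardStep (n k : ℕ) (a b : ℤ) (D : TwoDiag) : TwoDiag :=
  let c : ℤ := (n : ℤ) - k
  let u := Function.update D.u k a
  let v := Function.update D.v k b
  -- the diagonals with `1` subtracted from the entries of index smaller than `k`
  let uMinus : ℕ → ℤ := fun i => if i < k then u i - 1 else u i
  let vMinus : ℕ → ℤ := fun i => if i < k then v i - 1 else v i
  if v k = c then
    if u k = c then ⟨uMinus, vMinus⟩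
    else ⟨u, vMinus⟩
  else if v k = u k then
    if IsGelfandTsetlin (k + 1) (triangleOf (k + 1) (fun _ => c) ⟨uMinus, v⟩) then ⟨uMinus, v⟩
    else ⟨uMinus, Function.update vMinus k c⟩
  else if v k ≤ v (k - 1) then ⟨u, v⟩
  else
    let l := forwardL k v
    ⟨u, fun i => if k - l < i ∧ i ≤ k then c else if i = k - l then v k - l else v i⟩

/-- The two free diagonals of `X^(k)`, `k ≥ 1`, when the algorithm is run on the Gog trapezoid `X`.
The diagonal added at step `k` ends in `b_k = x_{n-k+1,n-k}` and `a_k = x_{n-k,n-k}`. (The value at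
`k = 0` plays no role.) -/
noncomputable def forwardStage (n : ℕ) (X : TriArray) : ℕ → TwoDiag
  | 0 => ⟨fun _ => n, fun _ => 0⟩
  | 1 => ⟨fun _ => n, fun _ => 0⟩
  | k + 2 => forwardStep n (k + 1) ((twoDiagOf n X).u (k + 1)) ((twoDiagOf n X).v (k + 1))
      (forwardStage n X (k + 1))

/-- The map from `(n, 2)` Gog trapezoids to `(n, 2)` GOGAm trapezoids. -/
noncomputable def gogToGogam (n : ℕ) (X : TriArray) : TriArray :=
  triangleOf n (fun _ => 1) (forwardStage n X n)

/-! ### The inverse algorithm -/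

/-- `l = 1 + max {j | v_{k-j} = n - k}`, with `0 ≤ j ≤ k - 1`. -/
def backwardL (n k : ℕ) (v : ℕ → ℤ) : ℕ :=
  1 + Nat.findGreatest (fun j => v (k - j) = (n : ℤ) - k) (k - 1)

open scoped Classical in
/-- One step of the inverse algorithm, from the diagonals of `X^(k+1)` to those of `Z^(k)`. In the
order of the code, the rules are (i), (ii), (iiib), (ivb), (iiia), (iva). They are applied with
`n - k ≤ v_k ≤ u_k`. Entries of index larger than `k` are left alone. -/
noncomputable def backwardStep (n k : ℕ) (D : TwoDiag) : TwoDiag :=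
  let c : ℤ := (n : ℤ) - k
  let u := D.u
  let v := D.v
  -- the diagonals with `1` added to the entries of index smaller than `k`
  let uPlus : ℕ → ℤ := fun i => if i < k then u i + 1 else u i
  let vPlus : ℕ → ℤ := fun i => if i < k then v i + 1 else v i
  if v k = c then
    if u k = c then ⟨uPlus, vPlus⟩
    else if ∀ i, 1 ≤ i → i < k → v i < u i then ⟨u, vPlus⟩
    else
      let l := backwardL n k v
      if u k ≤ v (k - l) + l then ⟨uPlus, Function.update vPlus k (u k)⟩
      else ⟨u, fun i => if k - l ≤ i ∧ i < k then c + 1 else if i = k then v (k - l) + l else v i⟩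
  else if v k = u k then ⟨uPlus, v⟩
  else ⟨u, v⟩

/-- The inverse algorithm run on the GOGAm trapezoid `X`, after the `m` steps for
`k = n - 1, n - 2, …, n - m`. The entries of index smaller than `n - m` are those of `X^(n-m)`; the
entries `u_k`, `v_k` with `k ≥ n - m` are the recorded numbers `a_k`, `b_k`, the ends of the NW-SE
diagonals that form `Y^(n-m)`. -/
noncomputable def backwardStage (n : ℕ) (X : TriArray) : ℕ → TwoDiag
  | 0 => twoDiagOf n X
  | m + 1 => backwardStep n (n - (m + 1)) (backwardStage n X m)

/-- The map from `(n, 2)` GOGAm trapezoids to `(n, 2)` Gog trapezoids. (The last step of the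
algorithm, `k = 0`, moves the one-entry triangle `X^(1)` to the array unchanged.) -/
noncomputable def gogamToGog (n : ℕ) (X : TriArray) : TriArray :=
  triangleOf n (fun j => (j : ℤ)) (backwardStage n X (n - 1))

/-! ### Admissible diagonals and the insertion relation -/

/-! The whole argument takes place on the two free diagonals `u`, `v`.

On the GOGAm side, let `p` and `q` be the last and last but one entries of the rows of `X`. Applying
`ω_j` acts on them like removing the lowest row of a skew tableau and rectifying. Hence each
diagonal entry of `SX` is an explicit expression in the maximum of `q_j - p_{j-1}` over a range of
rows (`omegaOp_rectified`, `lastEntry_schutzenberger`). Bounding a maximum means bounding every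
term, so `SX` is Magog exactly when `X` satisfies the linear inequalities of `Admissible n 1`
(`magog_schutzenberger_iff`).

A single step of the algorithms is studied through the relation `Insertion k c Z W`, whose
constructors record what the rules test on both sides. It is the graph of the forward step on
`Insertable` diagonals and of the inverse step on `Admissible` ones: `Insertion.admissible` and
`Insertion.insertable` transport the two conditions, `insertion_forwardStep` and
`insertion_backwardStep` give existence, and `agree_forwardStep` and `agree_backwardStep` give
uniqueness on the meaningful indices (`Agree`).

The delicate point is the Gog inequality `b_{k+1} ≤ b_k`, because the rules `equalLow` and `slide`
overwrite `b_k` by `c`. `NextBound` recovers it from the current diagonals alone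
(`Insertion.nextBound_iff`), so that the steps can be chained in both directions.

Finally, `S` is a bijection on arrays that preserves Gelfand-Tsetlin triangles and fixes the last
row, which carries the whole trapezoid condition for `1`s. Alternating sign matrices enter through
their suffix sums, which are `0` or `1` and determine both the matrix and the Gog triangle. -/

namespace TwoDiag

/-- The two diagonals of an admissible triangle of size `k` whose other entries are `c`, with all
entries bounded below by `c`. -/
structure Admissible (k : ℕ) (c : ℤ) (D : TwoDiag) : Prop where
  u_zero : D.u 0 ≤ c + k - 1
  u_ge : ∀ i, i < k → c ≤ D.u i
  v_ge : ∀ i, 1 ≤ i → i < k → c ≤ D.v i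
  u_anti : ∀ i j, i ≤ j → j < k → D.u j ≤ D.u i
  v_anti : ∀ i j, 1 ≤ i → i ≤ j → j < k → D.v j ≤ D.v i
  v_le : ∀ i, 1 ≤ i → i < k → D.v i ≤ D.u i
  one : ∀ i, 1 ≤ i → i < k → D.u 0 - D.u i + D.v i ≤ c + k - 2
  two : ∀ i j, 1 ≤ i → i < j → j < k → D.u 0 - D.u i + D.v i - D.v j + 1 ≤ (j : ℤ) - 1

/-- The bound on the next entry `b` of the left diagonal that is imposed by the last inserted
entry, in terms of the diagonals of the triangle of size `k`. -/
def NextBound (k : ℕ) (c : ℤ) (D : TwoDiag) (b : ℤ) : Prop :=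
  b ≤ D.v (k - 1) ∨ (D.v (k - 1) = c ∧ (∃ i, 1 ≤ i ∧ i < k - 1 ∧ D.u i = D.v i) ∧
    ∃ m, 1 ≤ m ∧ m < k - 1 ∧ c < D.v m ∧ (∀ i, m < i → i < k → D.v i = c) ∧
      b ≤ D.v m + (k - 1) - m)

/-- The diagonals of index smaller than `k` are admissible and the entries of index `k` form a
diagonal that can be inserted. -/
structure Insertable (k : ℕ) (c : ℤ) (D : TwoDiag) : Prop where
  adm : D.Admissible k (c + 1)
  le_v : c ≤ D.v k
  v_le_u : D.v k ≤ D.u k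
  u_le : D.u k ≤ D.u (k - 1)
  v_lt : D.v k < D.u (k - 1)
  bound : 2 ≤ k → NextBound k (c + 1) D (D.v k)

/-- Equality of the entries with index smaller than `k`. -/
def Agree (k : ℕ) (D E : TwoDiag) : Prop :=
  ∀ i, i < k → D.u i = E.u i ∧ (1 ≤ i → D.v i = E.v i)

/-- The relation between the diagonals before and after the insertion of a diagonal. -/
inductive Insertion (k : ℕ) (c : ℤ) (Z W : TwoDiag) : Prop
  | low (hu : W.u k = Z.u k) (hv : W.v k = c) (h1 : Z.v k = c) (h2 : Z.u k = c)
      (hui : ∀ i, i < k → W.u i = Z.u i - 1)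
      (hvi : ∀ i, 1 ≤ i → i < k → W.v i = Z.v i - 1)
  | left (hu : W.u k = Z.u k) (hv : W.v k = c) (h1 : Z.v k = c) (h2 : c < Z.u k)
      (hui : ∀ i, i < k → W.u i = Z.u i)
      (hvi : ∀ i, 1 ≤ i → i < k → W.v i = Z.v i - 1)
      (hlt : ∀ i, 1 ≤ i → i < k → W.v i < W.u i)
  | equal (hu : W.u k = Z.u k) (hv : W.v k = Z.v k) (h1 : c < Z.v k) (h2 : Z.v k = Z.u k)
      (hui : ∀ i, i < k → W.u i = Z.u i - 1)
      (hvi : ∀ i, 1 ≤ i → i < k → W.v i = Z.v i)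
      (hle : ∀ i, 1 ≤ i → i < k → W.v i ≤ W.u i)
      (hlast : 2 ≤ k → Z.v k ≤ Z.v (k - 1))
  | equalLow (hu : W.u k = Z.u k) (hv : W.v k = c) (h1 : c < Z.v k) (h2 : Z.v k = Z.u k)
      (hui : ∀ i, i < k → W.u i = Z.u i - 1)
      (hvi : ∀ i, 1 ≤ i → i < k → W.v i = Z.v i - 1)
      (heq : ∃ i, 1 ≤ i ∧ i < k ∧ W.u i = W.v i)
      (hm : ∀ m, 1 ≤ m → m < k → c < W.v m → (∀ i, m < i → i ≤ k → W.v i = c) →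
        W.u k ≤ W.v m + k - m)
  | keep (hu : W.u k = Z.u k) (hv : W.v k = Z.v k) (h1 : c < Z.v k) (h2 : Z.v k < Z.u k)
      (hui : ∀ i, i < k → W.u i = Z.u i)
      (hvi : ∀ i, 1 ≤ i → i < k → W.v i = Z.v i)
      (hk : 2 ≤ k) (hlast : Z.v k ≤ Z.v (k - 1))
  | slide (m : ℕ) (hu : W.u k = Z.u k) (hm1 : 1 ≤ m) (hmk : m < k) (h1 : c < W.v m)
      (hv : Z.v k = W.v m + k - m) (h2 : Z.v k < Z.u k)
      (hui : ∀ i, i < k → W.u i = Z.u i)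
      (hvi : ∀ i, 1 ≤ i → i < m → W.v i = Z.v i)
      (hmono : W.v m ≤ W.v (m - 1))
      (hlow : ∀ i, m < i → i ≤ k → W.v i = c)
      (hz : ∀ i, m ≤ i → i < k → Z.v i = c + 1)
      (heq : ∃ i, 1 ≤ i ∧ i < m ∧ W.u i = W.v i)

variable {k : ℕ} {c : ℤ} {Z W : TwoDiag}

theorem Insertion.u_last (h : Insertion k c Z W) : W.u k = Z.u k := by cases h <;> assumption

/-- Insertion produces admissible diagonals. -/
theorem Insertion.admissible (hk : 1 ≤ k) (hZ : Z.Insertable k c) (h : Insertion k c Z W) :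
    W.Admissible (k + 1) c := by
  obtain ⟨⟨z0, zu, zv, zua, zva, zvu, z1, z2⟩, hc, hvu, hul, hvl, hb⟩ := hZ
  have ul : ∀ i, i < k → Z.u (k - 1) ≤ Z.u i := fun i hi => zua i (k - 1) (by omega) (by omega)
  have vl : ∀ i, 1 ≤ i → i < k → Z.v (k - 1) ≤ Z.v i :=
    fun i h1 hi => zva i (k - 1) h1 (by omega) (by omega)
  cases h with
  | low hu hv h1 h2 hui hvi =>
    constructor
    · grind
    · grind
    · grind
    · grind
    · grind
    · grind
    · grind
    · grind
  | left hu hv h1 h2 hui hvi hlt =>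
    constructor
    · grind
    · grind
    · grind
    · grind
    · grind
    · grind
    · grind
    · grind
  | equal hu hv h1 h2 hui hvi hle hlast =>
    constructor
    · grind
    · grind
    · grind
    · grind
    · grind
    · grind
    · grind
    · grind
  | equalLow hu hv h1 h2 hui hvi heq hm =>
    clear hm
    constructor
    · grind
    · grind
    · grind
    · grind
    · grind
    · grind
    · grind
    · grind
  | keep hu hv h1 h2 hui hvi hk hlast =>
    constructor
    · grind
    · grind
    · grind
    · grind
    · grind
    · grind
    · grind
    · grind
  | slide m hu hm1 hmk h1 hv h2 hui hvi hmono hlow hz heq =>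
    obtain ⟨i0, hi1, him, he⟩ := heq
    -- The tie `u i0 = v i0` turns `two` at `(i0, m)` into a bound on `u 0` alone, sharper than
    -- `u_zero`; it handles all indices from `m` on.
    have h0 : Z.u 0 ≤ c + m - 1 := by
      have := z2 i0 m hi1 him hmk
      have := hz m le_rfl hmk
      have := hui i0 (by omega)
      have := hvi i0 (by omega)
      grind
    clear hb he z0
    have wm : ∀ i, 1 ≤ i → i < m → W.v m ≤ W.v i := fun i hp hi => by
      have := hvi (m - 1) (by omega) (by omega)
      have := zva i (m - 1) hp (by omega) (by omega)
      have := hvi i hp hi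
      omega
    have wk : ∀ i, m ≤ i → i < k → W.v m < Z.u i := fun i hp hi => by
      have := ul i hi
      omega
    have wl : ∀ i, 1 ≤ i → i ≤ k → i < m ∨ i = m ∨ (m < i ∧ W.v i = c) := fun i hp hi => by
      have := hlow i
      omega
    have uk : ∀ i, i ≤ k → Z.u k ≤ W.u i := fun i hi => by
      rcases hi.lt_or_eq with hi | rfl
      · have := ul i hi
        have := hui i hi
        omega
      · exact hu.ge
    have u0 := hui 0 (by omega)
    constructor
    · push_cast
      omega
    · intro i hi
      have := uk i (by omega)
      omega
    · intro i hp hi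
      rcases wl i hp (by omega) with h | rfl | h
      · have := wm i hp h
        omega
      · omega
      · omega
    · intro i j hij hj
      rcases (Nat.lt_succ_iff.1 hj).lt_or_eq with h | rfl
      · rw [hui i (by omega), hui j h]
        exact zua i j hij h
      · exact hu.le.trans (uk i hij)
    · intro i j hp hij hj
      have := hlow i
      rcases lt_trichotomy j m with h | rfl | h
      · rw [hvi i hp (by omega), hvi j (by omega) h]
        exact zva i j hp hij (by omega)
      · rcases hij.lt_or_eq with h | rfl
        · exact wm i hp h
        · exact le_rfl
      · rw [hlow j h (by omega)]
        rcases lt_trichotomy i m with h | rfl | h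
        · linarith [wm i hp h]
        · omega
        · omega
    · intro i hp hi
      have := uk i (by omega)
      rcases wl i hp (by omega) with h | rfl | h
      · rw [hvi i hp h, hui i (by omega)]
        exact zvu i hp (by omega)
      · omega
      · omega
    · intro i hp hi
      have := uk i (by omega)
      push_cast
      rcases wl i hp (by omega) with h | rfl | h
      · have := z1 i hp (by omega)
        rw [hvi i hp h, hui i (by omega)]
        omega
      · omega
      · omega
    · intro i j hp hij hj
      have := uk i (by omega)
      rcases wl i hp (by omega) with h | rfl | h
      · rw [hvi i hp h, hui i (by omega), u0]
        rcases lt_trichotomy j m with hjm | rfl | hjm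
        · rw [hvi j (by omega) hjm]
          exact z2 i j hp hij (by omega)
        · have := z2 i j hp h hmk
          have := hz j le_rfl hmk
          omega
        · have := z2 i m hp h hmk
          have := hz m le_rfl hmk
          rw [hlow j hjm (by omega)]
          omega
      · rw [hlow j hij (by omega)]
        omega
      · rw [hlow j (by omega) (by omega)]
        omega

end TwoDiag

/-! ### Gelfand-Tsetlin triangles as inequalities between two diagonals -/

theorem isGelfandTsetlin_triangleOf {m : ℕ} {c : ℤ} {D : TwoDiag} (hc : 0 < c)
    (hu : ∀ i, i < m → c ≤ D.u i) (hv : ∀ i, 1 ≤ i → i < m → c ≤ D.v i)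
    (hua : ∀ i, i + 1 < m → D.u (i + 1) ≤ D.u i)
    (hva : ∀ i, 1 ≤ i → i + 1 < m → D.v (i + 1) ≤ D.v i)
    (hvu : ∀ i, 1 ≤ i → i < m → D.v i ≤ D.u i) :
    IsGelfandTsetlin m (triangleOf m (fun _ => c) D) := by
  constructor
  · intro i j h1 h2 h3
    simp only [triangleOf, if_pos (And.intro h1 (And.intro h2 h3))]
    split_ifs with h h'
    · exact hc.trans_le (hu _ (by omega))
    · exact hc.trans_le (hv _ (by omega) (by omega))
    · exact hc
  · intro i j h
    simp only [triangleOf, if_neg h]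
  · intro i j h1 h2 h3
    simp only [triangleOf, if_pos (show 1 ≤ j ∧ j ≤ i + 1 ∧ i + 1 ≤ m by omega),
      if_pos (show 1 ≤ j ∧ j ≤ i ∧ i ≤ m by omega)]
    rcases h2.lt_or_eq with h | rfl
    · rw [if_neg (by omega), if_neg (by omega), if_neg (by omega)]
      split_ifs with h'
      · exact hv _ (by omega) (by omega)
      · exact le_rfl
    · rw [if_neg (by omega), if_pos rfl, if_pos rfl]
      exact hvu _ (by omega) (by omega)
  · intro i j h1 h2 h3
    simp only [triangleOf, if_pos (show 1 ≤ j + 1 ∧ j + 1 ≤ i + 1 ∧ i + 1 ≤ m by omega),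
      if_pos (show 1 ≤ j ∧ j ≤ i ∧ i ≤ m by omega), Nat.add_right_cancel_iff]
    split_ifs with h h'
    · have := hua (m - (i + 1)) (by omega)
      rwa [show m - (i + 1) + 1 = m - i by omega] at this
    · have := hva (m - (j + 1)) (by omega) (by omega)
      rwa [show m - (j + 1) + 1 = m - j by omega] at this
    · exact le_rfl

theorem IsGelfandTsetlin.twoDiag {m : ℕ} {X : TriArray} (h : IsGelfandTsetlin m X) :
    (∀ i, i < m → 1 ≤ (twoDiagOf m X).u i) ∧ (∀ i, 1 ≤ i → i < m → 1 ≤ (twoDiagOf m X).v i) ∧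
    (∀ i, i + 1 < m → (twoDiagOf m X).u (i + 1) ≤ (twoDiagOf m X).u i) ∧
    (∀ i, 1 ≤ i → i + 1 < m → (twoDiagOf m X).v (i + 1) ≤ (twoDiagOf m X).v i) ∧
    (∀ i, 1 ≤ i → i < m → (twoDiagOf m X).v i ≤ (twoDiagOf m X).u i) := by
  simp only [twoDiagOf]
  refine ⟨fun i hi => ?_, fun i h1 hi => ?_, fun i hi => ?_, fun i h1 hi => ?_, fun i h1 hi => ?_⟩
  · exact h.pos _ _ (by omega) (by omega) (by omega)
  · exact h.pos _ _ (by omega) (by omega) (by omega)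
  · have := h.right (m - (i + 1)) (m - (i + 1)) (by omega) (by omega) (by omega)
    rwa [show m - (i + 1) + 1 = m - i by omega] at this
  · have := h.right (m - (i + 1) + 1) (m - (i + 1)) (by omega) (by omega) (by omega)
    rwa [show m - (i + 1) + 1 = m - i by omega] at this ⊢
  · exact h.left (m - i) (m - i) (by omega) (by omega) (by omega)

theorem twoDiagOf_triangleOf {m : ℕ} {c : ℕ → ℤ} {D : TwoDiag} :
    (∀ i, i < m → (twoDiagOf m (triangleOf m c D)).u i = D.u i) ∧
      ∀ i, 1 ≤ i → i < m → (twoDiagOf m (triangleOf m c D)).v i = D.v i := by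
  refine ⟨fun i hi => ?_, fun i h1 hi => ?_⟩
  · simp only [twoDiagOf, triangleOf]
    rw [if_pos (by omega), if_pos trivial, Nat.sub_sub_self hi.le]
  · simp only [twoDiagOf, triangleOf]
    rw [if_pos (by omega), if_neg (by omega), if_pos trivial, Nat.sub_sub_self hi.le]

/-- The inequalities between the two diagonals of a Gelfand-Tsetlin triangle. -/
theorem TwoDiag.of_isGelfandTsetlin {m : ℕ} {c : ℕ → ℤ} {D : TwoDiag}
    (h : IsGelfandTsetlin m (triangleOf m c D)) :
    (∀ i, i < m → 1 ≤ D.u i) ∧ (∀ i, 1 ≤ i → i < m → 1 ≤ D.v i) ∧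
    (∀ i, i + 1 < m → D.u (i + 1) ≤ D.u i) ∧
    (∀ i, 1 ≤ i → i + 1 < m → D.v (i + 1) ≤ D.v i) ∧
    (∀ i, 1 ≤ i → i < m → D.v i ≤ D.u i) := by
  obtain ⟨h1, h2, h3, h4, h5⟩ := h.twoDiag
  obtain ⟨hu, hv⟩ := twoDiagOf_triangleOf (m := m) (c := c) (D := D)
  refine ⟨fun i hi => ?_, fun i hi hm => ?_, fun i hi => ?_, fun i hi hm => ?_, fun i hi hm => ?_⟩
  · rw [← hu i hi]; exact h1 i hi
  · rw [← hv i hi hm]; exact h2 i hi hm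
  · rw [← hu i (by omega), ← hu (i + 1) hi]; exact h3 i hi
  · rw [← hv i hi (by omega), ← hv (i + 1) (by omega) hm]; exact h4 i hi hm
  · rw [← hu i hm, ← hv i hi hm]; exact h5 i hi hm

/-! ### The index `k - l` of the sliding rules -/

namespace TwoDiag

variable {n k : ℕ} {Z W : TwoDiag}

theorem backwardL_eq {v : ℕ → ℤ} {m : ℕ} (hm : m < k) (h1 : 1 ≤ m)
    (h : ∀ i, 1 ≤ i → i ≤ m → v i ≠ (n : ℤ) - k)
    (hlow : ∀ i, m < i → i ≤ k → v i = (n : ℤ) - k) : backwardL n k v = k - m := by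
  have : Nat.findGreatest (fun j => v (k - j) = (n : ℤ) - k) (k - 1) = k - m - 1 := by
    rw [Nat.findGreatest_eq_iff]
    exact ⟨by omega, fun _ => hlow _ (by omega) (by omega),
      fun i hi hik => h _ (by omega) (by omega)⟩
  rw [backwardL, this]
  omega

/-- The greatest `l` corresponds to the least index `m = k - l` that passes the test. -/
theorem forwardL_eq {v : ℕ → ℤ} {m : ℕ} (hm : m < k) (h1 : 1 ≤ m)
    (hle : v m ≤ v k - (k - m)) (hlt : ∀ i, 1 ≤ i → i < m → v k - (k - i) < v i) :
    forwardL k v = k - m := by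
  rw [forwardL, Nat.findGreatest_eq_iff]
  refine ⟨by omega, fun _ => ?_, fun i hi hik => ?_⟩
  · rw [Nat.sub_sub_self hm.le, Nat.cast_sub hm.le]
    exact hle
  · have := hlt (k - i) (by omega) (by omega)
    rw [Nat.cast_sub (by omega)] at this
    omega

theorem exists_last_ne {v : ℕ → ℤ} {c : ℤ} {i : ℕ} (hik : i < k) (hi : v i ≠ c) (hk : v k = c) :
    ∃ m, i ≤ m ∧ m < k ∧ v m ≠ c ∧ ∀ j, m < j → j ≤ k → v j = c := by
  classical
  have hg := Nat.findGreatest_spec (P := fun j => v j ≠ c) hik.le hi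
  refine ⟨_, Nat.le_findGreatest hik.le hi, ?_, hg, fun j hj hjk => ?_⟩
  · refine lt_of_le_of_ne (Nat.findGreatest_le k) fun h => ?_
    rw [h] at hg
    exact hg hk
  · by_contra hne
    exact Nat.findGreatest_is_greatest hj hjk hne

end TwoDiag

/-! ### The inverse step inverts the insertion relation -/

namespace TwoDiag

variable {n k : ℕ} {Z W : TwoDiag}

theorem Insertion.agree_backwardStep (hZ : Z.Insertable k ((n : ℤ) - k))
    (hW : W.Admissible (k + 1) ((n : ℤ) - k)) (h : Insertion k ((n : ℤ) - k) Z W) :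
    Agree (k + 1) (backwardStep n k W) Z := by
  have key : ∀ D : TwoDiag, D.u k = Z.u k → D.v k = Z.v k → (∀ i, i < k → D.u i = Z.u i) →
      (∀ i, 1 ≤ i → i < k → D.v i = Z.v i) → Agree (k + 1) D Z := by
    intro D h1 h2 h3 h4 i hi
    rcases (Nat.lt_succ_iff.1 hi).lt_or_eq with h | rfl
    · exact ⟨h3 i h, fun h1 => h4 i h1 h⟩
    · exact ⟨h1, fun _ => h2⟩
  simp only [backwardStep]
  cases h with
  | low hu hv h1 h2 hui hvi =>
    rw [if_pos hv, if_pos (hu.trans h2)]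
    apply key <;> grind
  | left hu hv h1 h2 hui hvi hlt =>
    rw [if_pos hv, if_neg (by omega), if_pos hlt]
    apply key <;> grind
  | equal hu hv h1 h2 hui hvi hle hlast =>
    rw [if_neg (by omega), if_pos (by omega)]
    apply key <;> grind
  | equalLow hu hv h1 h2 hui hvi heq hm =>
    obtain ⟨i, hi1, hik, he⟩ := heq
    -- A tie `u i = v i` lies at height at least `u k > c`, so there is a last index with `v` above
    -- the fill value.
    have hi : W.v i ≠ (n : ℤ) - k := by
      have := hW.u_anti i k hik.le (by omega)
      omega
    obtain ⟨m, him, hmk, hne, hlow⟩ := exists_last_ne hik hi hv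
    have hpos : (n : ℤ) - k < W.v m :=
      lt_of_le_of_ne (hW.v_ge m (by omega) (by omega)) hne.symm
    have := hm m (by omega) hmk hpos hlow
    rw [if_pos hv, if_neg (by omega), if_neg (fun h => (h i hi1 hik).ne' he),
      backwardL_eq hmk (by omega) (fun j h1 hj => ?_) hlow, Nat.sub_sub_self hmk.le,
      if_pos (by rw [Nat.cast_sub hmk.le]; omega)]
    · apply key <;> grind
    · have := hW.v_anti j m h1 hj (by omega)
      omega
  | keep hu hv h1 h2 hui hvi hk hlast =>
    rw [if_neg (by omega), if_neg (by omega)]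
    apply key <;> grind
  | slide m hu hm1 hmk h1 hv h2 hui hvi hmono hlow hz heq =>
    obtain ⟨i, hi1, him, he⟩ := heq
    have := hlow k hmk le_rfl
    rw [if_pos this, if_neg (by omega), if_neg (fun h => (h i hi1 (by omega)).ne' he),
      backwardL_eq hmk (by omega) (fun j h1 hj => ?_) hlow, Nat.sub_sub_self hmk.le,
      if_neg (by rw [Nat.cast_sub hmk.le]; omega)]
    · apply key <;> grind
    · have := hW.v_anti j m h1 hj (by omega)
      omega

theorem Admissible.insertion_backwardStep (hk : 1 ≤ k) (hW : W.Admissible (k + 1) ((n : ℤ) - k)) :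
    Insertion k ((n : ℤ) - k) (backwardStep n k W) W := by
  obtain ⟨w0, wu, wv, wua, wva, wvu, w1, w2⟩ := hW
  have uk : ∀ i, i ≤ k → W.u k ≤ W.u i := fun i hi => wua i k hi (by omega)
  have vk : ∀ i, 1 ≤ i → i ≤ k → W.v k ≤ W.v i := fun i h1 hi => wva i k h1 hi (by omega)
  have uk' := wu k (by omega)
  have vk' := wv k hk (by omega)
  have wvuk := wvu k hk (by omega)
  simp only [backwardStep]
  by_cases hv : W.v k = (n : ℤ) - k
  · rw [if_pos hv]
    by_cases hu : W.u k = (n : ℤ) - k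
    · rw [if_pos hu]
      refine .low ?_ ?_ ?_ ?_ ?_ ?_ <;> grind
    · rw [if_neg hu]
      by_cases hlt : ∀ i, 1 ≤ i → i < k → W.v i < W.u i
      · rw [if_pos hlt]
        refine .left ?_ ?_ ?_ ?_ ?_ ?_ ?_ <;> grind
      · rw [if_neg hlt]
        push Not at hlt
        obtain ⟨i, hi1, hik, he⟩ := hlt
        have he : W.u i = W.v i := le_antisymm he (wvu i hi1 (by omega))
        have hi : W.v i ≠ (n : ℤ) - k := by
          have := uk i hik.le
          omega
        obtain ⟨m, him, hmk, hne, hlow⟩ := exists_last_ne hik hi hv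
        have hpos : (n : ℤ) - k < W.v m :=
          lt_of_le_of_ne (wv m (by omega) (by omega)) hne.symm
        rw [backwardL_eq hmk (by omega) (fun j h1 hj => ?_) hlow, Nat.sub_sub_self hmk.le,
          Nat.cast_sub hmk.le]
        · split_ifs with hle
          · refine .equalLow ?_ hv ?_ ?_ ?_ ?_ ⟨i, hi1, hik, he⟩ ?_
            · grind
            · grind
            · grind
            · grind
            · grind
            · intro m' h1 hmk' hpos' hlow'
              have : m' = m := by
                rcases lt_trichotomy m' m with h | h | h
                · have := hlow' m h hmk.le
                  omega
                · exact h
                · have := hlow m' h hmk'.le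
                  omega
              subst this
              omega
          -- A tie at `m` itself would give `W.v m = W.u m ≥ W.u k`, against the test that selects
          -- this rule.
          · have him' : i < m := by
              refine lt_of_le_of_ne him fun h => ?_
              subst h
              have := uk i hik.le
              omega
            refine .slide m ?_ (by omega) hmk hpos ?_ ?_ ?_ ?_ ?_ hlow ?_ ⟨i, hi1, him', he⟩
            · grind
            · grind
            · grind
            · grind
            · grind
            · exact wva (m - 1) m (by omega) (by omega) (by omega)
            · grind
        · have := wva j m h1 hj (by omega)
          omega
  · rw [if_neg hv]
    by_cases hu : W.v k = W.u k
    · rw [if_pos hu]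
      refine .equal ?_ ?_ ?_ ?_ ?_ ?_ ?_ ?_ <;> grind
    · rw [if_neg hu]
      -- For `k = 1`, `u_zero` gives `u 0 ≤ c + 1`, which leaves no room for `c < v 1 < u 1 ≤ u 0`.
      have h2 : 2 ≤ k := by
        by_contra h
        obtain rfl : k = 1 := by omega
        have := uk 0 (by omega)
        push_cast at *
        omega
      refine .keep ?_ ?_ ?_ ?_ ?_ ?_ h2 ?_ <;> grind

/-- The room for raising the diagonals comes from index `k` of `W`. If `W.u k = W.v k`, then `one`
at `k` bounds `u 0`; if `W.v k = c`, then `two` at `(i, k)` sharpens `one` at `i`, and bounds `u 0`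
when `i` is a tie. -/
theorem Insertion.insertable (hk : 1 ≤ k) {c : ℤ} (hW : W.Admissible (k + 1) c)
    (h : Insertion k c Z W) : Z.Insertable k c := by
  obtain ⟨w0, wu, wv, wua, wva, wvu, w1, w2⟩ := hW
  have uk : ∀ i, i ≤ k → W.u k ≤ W.u i := fun i hi => wua i k hi (by omega)
  have vk : ∀ i, 1 ≤ i → i ≤ k → W.v k ≤ W.v i := fun i h1 hi => wva i k h1 hi (by omega)
  have uk' := wu k (by omega)
  have vk' := wv k hk (by omega)
  have wvuk := wvu k hk (by omega)
  have w1k := w1 k hk (by omega)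
  have w2k := fun i h1 hi => w2 i k h1 hi (by omega)
  have uk1 := uk (k - 1) (by omega)
  push_cast at *
  cases h with
  | low hu hv h1 h2 hui hvi =>
    refine ⟨⟨?_, ?_, ?_, ?_, ?_, ?_, ?_, ?_⟩, ?_, ?_, ?_, ?_, fun h2 => Or.inl ?_⟩ <;> grind
  | left hu hv h1 h2 hui hvi hlt =>
    refine ⟨⟨?_, ?_, ?_, ?_, ?_, ?_, ?_, ?_⟩, ?_, ?_, ?_, ?_, fun h2 => Or.inl ?_⟩ <;> grind
  | equal hu hv h1 h2 hui hvi hle hlast =>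
    refine ⟨⟨?_, ?_, ?_, ?_, ?_, ?_, ?_, ?_⟩, ?_, ?_, ?_, ?_, fun h2 => Or.inl ?_⟩ <;> grind
  | equalLow hu hv h1 h2 hui hvi heq hm =>
    obtain ⟨i, hi1, hik, he⟩ := heq
    have hi := uk i hik.le
    obtain ⟨m, him, hmk, hne, hlow⟩ := exists_last_ne hik (show W.v i ≠ c by omega) hv
    have hpos : c < W.v m := lt_of_le_of_ne (wv m (by omega) (by omega)) hne.symm
    have hmb := hm m (by omega) hmk hpos hlow
    have w2i := w2k i hi1 hik
    clear hm
    refine ⟨⟨?_, ?_, ?_, ?_, ?_, ?_, ?_, ?_⟩, ?_, ?_, ?_, ?_, fun h2 => ?_⟩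
    rotate_right
    · rcases (show m ≤ k - 1 by omega).lt_or_eq with h | rfl
      · refine Or.inr ⟨?_, ⟨i, hi1, ?_, ?_⟩, m, by omega, h, ?_, ?_, ?_⟩ <;> grind
      · refine Or.inl ?_
        grind
    all_goals grind
  | keep hu hv h1 h2 hui hvi hk hlast =>
    refine ⟨⟨?_, ?_, ?_, ?_, ?_, ?_, ?_, ?_⟩, ?_, ?_, ?_, ?_, fun h2 => Or.inl ?_⟩ <;> grind
  | slide m hu hm1 hmk h1 hv h2 hui hvi hmono hlow hz heq =>
    obtain ⟨i0, hi1, him, he⟩ := heq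
    -- The index `m + 1 ≤ k` is where `W.v` has just dropped to `c`; the tie cancels the remaining
    -- terms of `two`.
    have u0 : W.u 0 ≤ c + m - 1 := by
      have := w2 i0 (m + 1) hi1 (by omega) (by omega)
      have := hlow (m + 1) (by omega) (by omega)
      push_cast at *
      omega
    have ub : ∀ i, i ≤ k → c + 3 ≤ W.u i := fun i hi => by
      have := uk i hi
      omega
    have vm : ∀ i, 1 ≤ i → i < m → W.v m ≤ W.v i := fun i hp hi => wva i m hp hi.le (by omega)
    have wi := ub i0 (by omega)
    have wik := uk i0 (by omega)
    have zi := hvi i0 hi1 him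
    -- The witness of `NextBound` for `Z` is its last entry above `c + 1`. It lies before `m`, where
    -- `W.v m' ≥ W.v m`, so its bound dominates `W.v m + k - m`.
    obtain ⟨m', him', hmk', hne, hlow'⟩ := exists_last_ne (v := Z.v) (c := c + 1) (k := k - 1)
      (show i0 < k - 1 by omega) (by omega) (hz _ (by omega) (by omega))
    have hmm : m' < m := by
      by_contra hh
      exact hne (hz m' (by omega) (by omega))
    have vm' := vm m' (by omega) hmm
    have zm' := hvi m' (by omega) hmm
    clear uk vk w0 w1k w2k
    refine ⟨⟨?_, ?_, ?_, ?_, ?_, ?_, ?_, ?_⟩, ?_, ?_, ?_, ?_, fun h2 => Or.inr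
      ⟨?_, ⟨i0, hi1, ?_, ?_⟩, m', by omega, by omega, ?_, ?_, ?_⟩⟩
    · rw [← hui 0 (by omega)]
      omega
    · intro i hi
      rw [← hui i hi]
      linarith [ub i hi.le]
    · intro i hp hi
      rcases lt_or_ge i m with h | h
      · rw [← hvi i hp h]
        linarith [vm i hp h]
      · exact (hz i h hi).ge
    · intro i j hij hj
      rw [← hui i (by omega), ← hui j hj]
      exact wua i j hij (by omega)
    · intro i j hp hij hj
      rcases lt_or_ge j m with h | h
      · rw [← hvi i hp (by omega), ← hvi j (by omega) h]
        exact wva i j hp hij (by omega)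
      · rw [hz j h hj]
        rcases lt_or_ge i m with h' | h'
        · rw [← hvi i hp h']
          linarith [vm i hp h']
        · exact (hz i h' (by omega)).ge
    · intro i hp hi
      rw [← hui i hi]
      rcases lt_or_ge i m with h | h
      · rw [← hvi i hp h]
        exact wvu i hp (by omega)
      · linarith [hz i h hi, ub i hi.le]
    · intro i hp hi
      rw [← hui i hi, ← hui 0 (by omega)]
      rcases lt_or_ge i m with h | h
      · rw [← hvi i hp h]
        have := w1 i hp (by omega)
        omega
      · linarith [hz i h hi, ub i hi.le, (Nat.cast_lt (α := ℤ)).2 hmk]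
    · intro i j hp hij hj
      rw [← hui i (by omega), ← hui 0 (by omega)]
      rcases lt_or_ge j m with h | h
      · rw [← hvi i hp (by omega), ← hvi j (by omega) h]
        exact w2 i j hp hij (by omega)
      · rw [hz j h hj]
        rcases lt_or_ge i m with h' | h'
        · rw [← hvi i hp h']
          have := w2 i (m + 1) hp (by omega) (by omega)
          have := hlow (m + 1) (by omega) (by omega)
          push_cast at *
          omega
        · have := hz i h' (by omega)
          have := ub i (by omega)
          omega
    · omega
    · omega
    · rw [← hui (k - 1) (by omega), ← hu]
      exact uk1
    · rw [← hui (k - 1) (by omega)]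
      omega
    · exact hz (k - 1) (by omega) (by omega)
    · omega
    · rw [← hui i0 (by omega), ← zi, he]
    · omega
    · intro i h h'
      exact hlow' i h (by omega)
    · omega

end TwoDiag

/-! ### The forward step realizes the insertion relation -/

namespace TwoDiag

variable {n k : ℕ} {Z W : TwoDiag}

open scoped Classical in
/-- The rules of the algorithm in terms of the diagonals `Z` that include the new entries. -/
theorem forwardStep_eq {a b : ℤ} {D : TwoDiag} (hu : Function.update D.u k a = Z.u)
    (hv : Function.update D.v k b = Z.v) : forwardStep n k a b D =
      if Z.v k = (n : ℤ) - k then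
        if Z.u k = (n : ℤ) - k then
          ⟨fun i => if i < k then Z.u i - 1 else Z.u i, fun i => if i < k then Z.v i - 1 else Z.v i⟩
        else ⟨Z.u, fun i => if i < k then Z.v i - 1 else Z.v i⟩
      else if Z.v k = Z.u k then
        if IsGelfandTsetlin (k + 1) (triangleOf (k + 1) (fun _ => (n : ℤ) - k)
            ⟨fun i => if i < k then Z.u i - 1 else Z.u i, Z.v⟩) then
          ⟨fun i => if i < k then Z.u i - 1 else Z.u i, Z.v⟩
        else ⟨fun i => if i < k then Z.u i - 1 else Z.u i,
          fun i => if i = k then (n : ℤ) - k else if i < k then Z.v i - 1 else Z.v i⟩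
      else if Z.v k ≤ Z.v (k - 1) then Z
      else ⟨Z.u, fun i => if k - forwardL k Z.v < i ∧ i ≤ k then (n : ℤ) - k
        else if i = k - forwardL k Z.v then Z.v k - forwardL k Z.v else Z.v i⟩ := by
  have : ∀ f : ℕ → ℤ, Function.update f k ((n : ℤ) - k) =
      fun i => if i = k then (n : ℤ) - k else f i := fun f => by
    funext i
    rw [Function.update_apply]
  unfold forwardStep
  dsimp only
  rw [hu, hv, this]

theorem Insertable.insertion_forwardStep (hk : 1 ≤ k) (hkn : k < n)
    (hZ : Z.Insertable k ((n : ℤ) - k)) :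
    Insertion k ((n : ℤ) - k) Z (forwardStep n k (Z.u k) (Z.v k) Z) := by
  obtain ⟨⟨z0, zu, zv, zua, zva, zvu, z1, z2⟩, hc, hvu, hul, hvl, hb⟩ := hZ
  have ul : ∀ i, i < k → Z.u (k - 1) ≤ Z.u i := fun i hi => zua i (k - 1) (by omega) (by omega)
  have vl : ∀ i, 1 ≤ i → i < k → Z.v (k - 1) ≤ Z.v i :=
    fun i h1 hi => zva i (k - 1) h1 (by omega) (by omega)
  -- For `k = 1`, `v 1 < u 0 ≤ c + 1` forces `v 1 ≤ c`.
  have h2 : (n : ℤ) - k < Z.v k → 2 ≤ k := by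
    intro h
    by_contra h'
    obtain rfl : k = 1 := by omega
    push_cast at *
    omega
  rw [forwardStep_eq (Function.update_eq_self _ _) (Function.update_eq_self _ _)]
  split_ifs with h1 hu hu hgt hle
  · refine .low ?_ ?_ ?_ ?_ ?_ ?_ <;> grind
  · refine .left ?_ ?_ ?_ ?_ ?_ ?_ ?_ <;> grind
  · obtain ⟨-, -, g1, g2, g3⟩ := of_isGelfandTsetlin hgt
    refine .equal ?_ ?_ ?_ hu ?_ ?_ ?_ ?_
    · grind
    · grind
    · grind
    · grind
    · grind
    · intro i hi hik
      exact g3 i hi (by omega)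
    · intro h
      have : Z.v (k - 1 + 1) ≤ Z.v (k - 1) := g2 (k - 1) (by omega) (by omega)
      rwa [Nat.sub_add_cancel hk] at this
  · have hpos : (n : ℤ) - k < Z.v k := by omega
    have hk2 := h2 hpos
    -- Without a tie, `NextBound` reduces to `v k ≤ v (k - 1)`, and lowering `u` alone would still
    -- give a Gelfand-Tsetlin triangle.
    have heq : ∃ i, 1 ≤ i ∧ i < k ∧ Z.u i = Z.v i := by
      by_contra! hne
      rcases hb hk2 with hb | ⟨-, ⟨i, hi, hik, he⟩, -⟩
      · have hlt : ∀ i, 1 ≤ i → i < k → Z.v i ≤ Z.u i - 1 := fun i hi hik => by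
          have := hne i hi hik
          have := zvu i hi hik
          omega
        refine hgt (isGelfandTsetlin_triangleOf (by omega) ?_ ?_ ?_ ?_ ?_)
        · grind
        · grind
        · intro i hi
          have := zua i (i + 1) (by omega)
          grind
        · intro i hi hik
          rcases (show i + 1 ≤ k by omega).lt_or_eq with h | h
          · exact zva i (i + 1) hi (by omega) h
          · obtain rfl : i = k - 1 := by omega
            have hb' := hb
            rw [← h] at hb'
            simpa using hb'
        · grind
      · exact hne i hi (by omega) he
    obtain ⟨i, hi, hik, he⟩ := heq
    refine .equalLow ?_ ?_ hpos hu ?_ ?_ ⟨i, hi, hik, ?_⟩ ?_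
    · grind
    · grind
    · grind
    · grind
    · grind
    · intro m hm hmk hmc hlow
      simp only [lt_irrefl, if_false, if_true, hmk, hmk.ne] at hmc ⊢
      rcases hb hk2 with hb | ⟨hl, -, m', hm', hmk', hmc', hlow', hb⟩
      · have := hlow (k - 1)
        have := vl m hm hmk
        grind
      · have : m' = m := by
          rcases lt_trichotomy m' m with h | h | h
          · have := hlow' m h hmk
            omega
          · exact h
          · have := hlow m' h (by omega)
            grind
        grind
  · refine .keep ?_ ?_ ?_ ?_ ?_ ?_ ?_ hle <;> grind
  · have hpos : (n : ℤ) - k < Z.v k := by omega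
    have hk2 := h2 hpos
    obtain ⟨hl, ⟨i0, hi, hik, he⟩, m', hm', hmk', hmc', hlow', hb⟩ := (hb hk2).resolve_left hle
    -- The least such `p` is `k - l`; it is below `k` because `k - 1` already qualifies when `v (k -
    -- 1) < v k`.
    have hex : ∃ p, 1 ≤ p ∧ Z.v p ≤ Z.v k - (k - p) := ⟨k, hk, by simp⟩
    classical
    obtain ⟨hp, hpk⟩ := Nat.find_spec hex
    have hmin : ∀ i, 1 ≤ i → i < Nat.find hex → Z.v k - (k - i) < Z.v i := fun i hi hif => by
      have := Nat.find_min hex hif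
      push Not at this
      exact this hi
    generalize Nat.find hex = p at *
    have hpk' : p < k := by
      by_contra h
      have := hmin (k - 1) (by omega) (by omega)
      rw [Nat.cast_sub hk] at this
      push_cast at this
      omega
    -- The bound from `NextBound` says that `m'` fails the test by one; hence all entries from `p`
    -- on have the fill value `c + 1`.
    have hpm : m' < p := by
      by_contra h
      have : Z.v m' ≤ Z.v p := zva p m' hp (by omega) (by omega)
      omega
    have hz : ∀ i, p ≤ i → i < k → Z.v i = (n : ℤ) - k + 1 :=
      fun i h h' => hlow' i (by omega) h'
    have hi0 : i0 < p := by
      by_contra h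
      have := hz i0 (by omega) (by omega)
      have := ul i0 (by omega)
      omega
    rw [forwardL_eq hpk' hp hpk hmin, Nat.sub_sub_self hpk'.le, Nat.cast_sub hpk'.le]
    have := hz p le_rfl hpk'
    refine .slide p ?_ hp hpk' ?_ ?_ ?_ ?_ ?_ ?_ ?_ hz ⟨i0, hi, hi0, ?_⟩
    · rfl
    · simp only [lt_irrefl, false_and, if_false, if_true]
      omega
    · simp only [lt_irrefl, false_and, if_false, if_true]
      ring
    · exact lt_of_le_of_ne hvu hu
    · exact fun _ _ => rfl
    · intro i hi hip
      simp only
      rw [if_neg (by omega), if_neg (by omega)]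
    · simp only [lt_irrefl, false_and, if_false, if_true]
      rw [if_neg (by omega), if_neg (by omega)]
      have := hmin (p - 1) (by omega) (by omega)
      rw [Nat.cast_sub hp] at this
      push_cast at this
      omega
    · intro i hi hip
      simp only
      rw [if_pos (by omega)]
    · simp only
      rw [if_neg (by omega), if_neg (by omega), he]

theorem Insertion.agree_forwardStep (hk : 1 ≤ k) (hkn : k < n)
    (hW : W.Admissible (k + 1) ((n : ℤ) - k)) (h : Insertion k ((n : ℤ) - k) Z W) :
    Agree (k + 1) (forwardStep n k (Z.u k) (Z.v k) Z) W := by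
  have hZ := h.insertable hk hW
  have key : ∀ D : TwoDiag, D.u k = W.u k → D.v k = W.v k → (∀ i, i < k → D.u i = W.u i) →
      (∀ i, 1 ≤ i → i < k → D.v i = W.v i) → Agree (k + 1) D W := by
    intro D h1 h2 h3 h4 i hi
    rcases (Nat.lt_succ_iff.1 hi).lt_or_eq with h | rfl
    · exact ⟨h3 i h, fun h1 => h4 i h1 h⟩
    · exact ⟨h1, fun _ => h2⟩
  rw [forwardStep_eq (Function.update_eq_self _ _) (Function.update_eq_self _ _)]
  cases h with
  | low hu hv h1 h2 hui hvi =>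
    rw [if_pos h1, if_pos h2]
    apply key <;> grind
  | left hu hv h1 h2 hui hvi hlt =>
    rw [if_pos h1, if_neg (by omega)]
    apply key <;> grind
  | equal hu hv h1 h2 hui hvi hle hlast =>
    rw [if_neg (by omega), if_pos h2, if_pos]
    · apply key <;> grind
    · obtain ⟨w0, wu, wv, wua, wva, wvu, w1, w2⟩ := hW
      refine isGelfandTsetlin_triangleOf (by omega) ?_ ?_ ?_ ?_ ?_
      · grind
      · grind
      · intro i hi
        have := wua i (i + 1) (by omega) hi
        grind
      · intro i hi hik
        have := wva i (i + 1) hi (by omega) hik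
        grind
      · grind
  | equalLow hu hv h1 h2 hui hvi heq hm =>
    obtain ⟨i, hi, hik, he⟩ := heq
    rw [if_neg (by omega), if_pos h2, if_neg]
    · apply key <;> grind
    -- A tie after lowering both diagonals means `v i > u i` when only `u` is lowered.
    · intro hgt
      obtain ⟨-, -, -, -, g3⟩ := of_isGelfandTsetlin hgt
      have := g3 i hi (by omega)
      grind
  | keep hu hv h1 h2 hui hvi hk2 hlast =>
    rw [if_neg (by omega), if_neg (by omega), if_pos hlast]
    apply key <;> grind
  | slide m hu hm1 hmk h1 hv h2 hui hvi hmono hlow hz heq =>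
    obtain ⟨i, hi, him, he⟩ := heq
    have hmin : ∀ i, 1 ≤ i → i < m → Z.v k - (k - i) < Z.v i := fun i hi him => by
      rw [← hvi i hi him]
      have := hW.v_anti i m hi him.le (by omega)
      omega
    have hzm := hz m le_rfl hmk
    have hzk := hz (k - 1) (by omega) (by omega)
    rw [if_neg (by omega), if_neg (by omega), if_neg (by omega),
      forwardL_eq hmk hm1 (by omega) hmin, Nat.sub_sub_self hmk.le, Nat.cast_sub hmk.le]
    apply key <;> grind

/-- If `W.v k` still holds the inserted entry, the first alternative of `NextBound` is the claim.
After `slide` the inserted entry is read off as `W.v m + k - m`. After `equalLow` it equals `W.u k`,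
so `hb` gives the right side outright and `hm` the left. -/
theorem Insertion.nextBound_iff {c : ℤ} (hW : W.Admissible (k + 1) c)
    (h : Insertion k c Z W) {b : ℤ} (hb : b < W.u k) : NextBound (k + 1) c W b ↔ b ≤ Z.v k := by
  have uk : ∀ i, i ≤ k → W.u k ≤ W.u i := fun i hi => hW.u_anti i k hi (by omega)
  have huniq : ∀ m m', 1 ≤ m → m < k → c < W.v m → (∀ i, m < i → i ≤ k → W.v i = c) →
      1 ≤ m' → m' < k → c < W.v m' → (∀ i, m' < i → i ≤ k → W.v i = c) → m = m' := by
    intro m m' _ hm h hlow _ hm' h' hlow'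
    rcases lt_trichotomy m m' with hlt | heq | hlt
    · have := hlow m' hlt hm'.le
      omega
    · exact heq
    · have := hlow' m hlt hm.le
      omega
  simp only [NextBound, Nat.add_sub_cancel]
  cases h with
  | low hu hv h1 h2 hui hvi =>
    constructor
    · rintro (h | ⟨-, -, -⟩) <;> omega
    · exact fun h => Or.inl (by omega)
  | left hu hv h1 h2 hui hvi hlt =>
    constructor
    · rintro (h | ⟨-, ⟨i, hi, hik, he⟩, -⟩)
      · omega
      · exact absurd he (hlt i hi hik).ne'
    · exact fun h => Or.inl (by omega)
  | equal hu hv h1 h2 hui hvi hle hlast =>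
    constructor
    · rintro (h | ⟨h, -, -⟩) <;> omega
    · exact fun h => Or.inl (by omega)
  | equalLow hu hv h1 h2 hui hvi heq hm =>
    obtain ⟨i, hi, hik, he⟩ := heq
    have := uk i hik.le
    refine ⟨fun _ => by omega, fun h => Or.inr ⟨hv, ⟨i, hi, hik, he⟩, ?_⟩⟩
    obtain ⟨m, him, hmk, hne, hlow⟩ := exists_last_ne hik (show W.v i ≠ c by omega) hv
    have hpos : c < W.v m := lt_of_le_of_ne (hW.v_ge m (by omega) (by omega)) hne.symm
    have := hm m (by omega) hmk hpos hlow
    refine ⟨m, by omega, hmk, hpos, fun i h h' => hlow i h (by omega), ?_⟩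
    push_cast
    omega
  | keep hu hv h1 h2 hui hvi hk hlast =>
    constructor
    · rintro (h | ⟨h, -, -⟩) <;> omega
    · exact fun h => Or.inl (by omega)
  | slide m hu hm1 hmk h1 hv h2 hui hvi hmono hlow hz heq =>
    obtain ⟨i, hi, him, he⟩ := heq
    have hk0 := hlow k hmk le_rfl
    constructor
    · rintro (h | ⟨h, -, m', hm', hmk', hmc', hlow', hb'⟩)
      · omega
      · obtain rfl := huniq m m' hm1 hmk h1 hlow hm' hmk' hmc'
          fun i h h' => hlow' i h (by omega)
        push_cast at hb'
        omega
    · refine fun h => Or.inr ⟨hk0, ⟨i, hi, by omega, he⟩, m, hm1, hmk, h1,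
        fun i h h' => hlow i h (by omega), ?_⟩
      push_cast
      omega

end TwoDiag

/-! ### Running the direct algorithm on a Gog trapezoid -/

namespace TwoDiag

variable {n k : ℕ} {c : ℤ} {Z Z' W W' D E : TwoDiag}

theorem Agree.symm (h : Agree k D E) : Agree k E D :=
  fun i hi => ⟨(h i hi).1.symm, fun h1 => ((h i hi).2 h1).symm⟩

theorem Agree.trans {F : TwoDiag} (h : Agree k D E) (h' : Agree k E F) : Agree k D F :=
  fun i hi => ⟨(h i hi).1.trans (h' i hi).1, fun h1 => ((h i hi).2 h1).trans ((h' i hi).2 h1)⟩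

theorem Agree.mono {m : ℕ} (h : Agree k D E) (hm : m ≤ k) : Agree m D E :=
  fun i hi => h i (hi.trans_le hm)

theorem Agree.triangleOf_eq {f : ℕ → ℤ} (h : Agree n D E) :
    triangleOf n f D = triangleOf n f E := by
  funext i j
  simp only [triangleOf]
  split_ifs with h1 h2 h3
  · exact (h _ (by omega)).1
  · exact (h _ (by omega)).2 (by omega)
  · rfl
  · rfl

theorem agree_twoDiagOf_triangleOf {f : ℕ → ℤ} : Agree n (twoDiagOf n (triangleOf n f D)) D :=
  fun i hi => ⟨twoDiagOf_triangleOf.1 i hi, fun h1 => twoDiagOf_triangleOf.2 i h1 hi⟩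

theorem Admissible.congr (hk : 1 ≤ k) (hD : D.Admissible k c) (h : Agree k D E) :
    E.Admissible k c := by
  obtain ⟨z0, zu, zv, zua, zva, zvu, z1, z2⟩ := hD
  have hu : ∀ i, i < k → E.u i = D.u i := fun i hi => (h i hi).1.symm
  have hv : ∀ i, 1 ≤ i → i < k → E.v i = D.v i := fun i h1 hi => ((h i hi).2 h1).symm
  clear h
  constructor <;> grind

theorem NextBound.congr {b : ℤ} (hk : 2 ≤ k) (hD : NextBound k c D b) (h : Agree k D E) :
    NextBound k c E b := by
  have hu : ∀ i, i < k → D.u i = E.u i := fun i hi => (h i hi).1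
  have hv : ∀ i, 1 ≤ i → i < k → D.v i = E.v i := fun i h1 hi => (h i hi).2 h1
  rcases hD with hb | ⟨h1, ⟨i, hi, hik, he⟩, m, hm, hmk, hmc, hlow, hb⟩
  · refine Or.inl ?_
    rwa [← hv (k - 1) (by omega) (by omega)]
  · refine Or.inr ⟨?_, ⟨i, hi, hik, ?_⟩, m, hm, hmk, ?_, fun i h h' => ?_, ?_⟩
    · rwa [← hv (k - 1) (by omega) (by omega)]
    · rwa [← hv i hi (by omega), ← hu i (by omega)]
    · rwa [← hv m hm (by omega)]
    · rw [← hv i (by omega) h']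
      exact hlow i h h'
    · rwa [← hv m hm (by omega)]

theorem Insertion.congr (hk : 1 ≤ k) (h : Insertion k c Z W) (hZ : Agree (k + 1) Z Z')
    (hW : Agree (k + 1) W W') : Insertion k c Z' W' := by
  have zu : ∀ i, i ≤ k → Z.u i = Z'.u i := fun i hi => (hZ i (by omega)).1
  have zv : ∀ i, 1 ≤ i → i ≤ k → Z.v i = Z'.v i := fun i h1 hi => (hZ i (by omega)).2 h1
  have wu : ∀ i, i ≤ k → W.u i = W'.u i := fun i hi => (hW i (by omega)).1
  have wv : ∀ i, 1 ≤ i → i ≤ k → W.v i = W'.v i := fun i h1 hi => (hW i (by omega)).2 h1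
  clear hZ hW
  cases h with
  | low hu hv h1 h2 hui hvi => refine .low ?_ ?_ ?_ ?_ ?_ ?_ <;> grind
  | left hu hv h1 h2 hui hvi hlt => refine .left ?_ ?_ ?_ ?_ ?_ ?_ ?_ <;> grind
  | equal hu hv h1 h2 hui hvi hle hlast => refine .equal ?_ ?_ ?_ ?_ ?_ ?_ ?_ ?_ <;> grind
  | equalLow hu hv h1 h2 hui hvi heq hm =>
    obtain ⟨i, hi, hik, he⟩ := heq
    refine .equalLow ?_ ?_ ?_ ?_ ?_ ?_ ⟨i, hi, hik, ?_⟩ fun m hm1 hmk hmc hlow => ?_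
    rotate_right
    · rw [← wu k le_rfl, ← wv m hm1 hmk.le]
      refine hm m hm1 hmk ?_ fun i h h' => ?_
      · rwa [wv m hm1 hmk.le]
      · rw [wv i (by omega) h']
        exact hlow i h h'
    all_goals clear hm
    all_goals grind
  | keep hu hv h1 h2 hui hvi hk hlast => refine .keep ?_ ?_ ?_ ?_ ?_ ?_ hk ?_ <;> grind
  | slide m hu hm1 hmk h1 hv h2 hui hvi hmono hlow hz heq =>
    obtain ⟨i, hi, him, he⟩ := heq
    refine .slide m ?_ hm1 hmk ?_ ?_ ?_ ?_ ?_ ?_ ?_ ?_ ⟨i, hi, him, ?_⟩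
    · rw [← wu k le_rfl, ← zu k le_rfl, hu]
    · rwa [← wv m hm1 hmk.le]
    · rw [← wv m hm1 hmk.le, ← zv k hk le_rfl, hv]
    · rwa [← zv k hk le_rfl, ← zu k le_rfl]
    · intro i hi
      rw [← wu i hi.le, ← zu i hi.le, hui i hi]
    · intro i h1 hi
      rw [← wv i h1 (by omega), ← zv i h1 (by omega), hvi i h1 hi]
    · rwa [← wv m hm1 hmk.le, ← wv (m - 1) (by omega) (by omega)]
    · intro i h h'
      rw [← wv i (by omega) h']
      exact hlow i h h'
    · intro i h h'
      rw [← zv i (by omega) h'.le]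
      exact hz i h h'
    · rw [← wu i (by omega), ← wv i hi (by omega), he]

theorem Admissible.isAdmissible (hk : 1 ≤ k) (hkn : k ≤ n)
    (h : D.Admissible k ((n : ℤ) - k + 1)) : IsAdmissible n k D := by
  obtain ⟨z0, zu, zv, zua, zva, zvu, z1, z2⟩ := h
  refine ⟨isGelfandTsetlin_triangleOf (by omega) zu zv (fun i hi => zua _ _ (by omega) hi)
    (fun i h1 hi => zva _ _ h1 (by omega) hi) zvu, by omega, fun i h1 hi => ?_,
    fun i j h1 hij hj => z2 i j h1 hij (by omega)⟩
  have := z1 i h1 (by omega)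
  omega

/-- The two free diagonals of an `(n, 2)` Gog trapezoid. -/
structure IsGogPair (n : ℕ) (D : TwoDiag) : Prop where
  u_zero : D.u 0 = n
  le_v : ∀ k, 1 ≤ k → k < n → (n : ℤ) - k ≤ D.v k
  v_le : ∀ k, 1 ≤ k → k < n → D.v k ≤ D.u k
  u_le : ∀ k, 1 ≤ k → k < n → D.u k ≤ D.u (k - 1)
  v_lt : ∀ k, 1 ≤ k → k < n → D.v k < D.u (k - 1)
  v_anti : ∀ k, 1 ≤ k → k + 1 < n → D.v (k + 1) ≤ D.v k

/-- The diagonals `D` of a triangle of size `k` together with the new entries of index `k`. -/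
def extend (k : ℕ) (D E : TwoDiag) : TwoDiag :=
  ⟨Function.update D.u k (E.u k), Function.update D.v k (E.v k)⟩

theorem agree_extend : Agree k D (extend k D E) := fun i hi => by
  simp [extend, hi.ne]

theorem extend_u : (extend k D E).u k = E.u k := by simp [extend]

theorem extend_v : (extend k D E).v k = E.v k := by simp [extend]

theorem Agree.extend_left (h : Agree k D Z) (hu : E.u k = Z.u k) (hv : E.v k = Z.v k) :
    Agree (k + 1) (extend k D E) Z := by
  intro i hi
  rcases (Nat.lt_succ_iff.1 hi).lt_or_eq with h' | rfl
  · simpa [extend, h'.ne] using h i h'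
  · simp [extend, hu, hv]

theorem forwardStage_succ {X : TriArray} (hk : 1 ≤ k) : forwardStage n X (k + 1) =
    forwardStep n k ((extend k (forwardStage n X k) (twoDiagOf n X)).u k)
      ((extend k (forwardStage n X k) (twoDiagOf n X)).v k)
      (extend k (forwardStage n X k) (twoDiagOf n X)) := by
  obtain ⟨k, rfl⟩ := Nat.exists_eq_add_of_le' hk
  rw [forwardStage, forwardStep_eq
    (Z := extend (k + 1) (forwardStage n X (k + 1)) (twoDiagOf n X)) rfl rfl,
    forwardStep_eq (Function.update_eq_self _ _) (Function.update_eq_self _ _)]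

/-- The claims need each other: the third converts the Gog inequality for consecutive `v` into
`NextBound`, which makes the next diagonal insertable, and the insertion returns the third claim for
`k + 1` through `nextBound_iff`. -/
theorem IsGogPair.forwardStage {X : TriArray} (hX : (twoDiagOf n X).IsGogPair n) (hk : 1 ≤ k)
    (hkn : k ≤ n) :
    (forwardStage n X k).Admissible k ((n : ℤ) - k + 1) ∧
      (forwardStage n X k).u (k - 1) = (twoDiagOf n X).u (k - 1) ∧
      (2 ≤ k → ∀ b < (twoDiagOf n X).u (k - 1),
        NextBound k ((n : ℤ) - k + 1) (forwardStage n X k) b ↔ b ≤ (twoDiagOf n X).v (k - 1)) ∧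
      (k < n → Insertion k ((n : ℤ) - k) (extend k (forwardStage n X k) (twoDiagOf n X))
        (forwardStage n X (k + 1))) := by
  have hins : ∀ k, 1 ≤ k → k < n →
      (_root_.forwardStage n X k).Admissible k ((n : ℤ) - k + 1) →
      (_root_.forwardStage n X k).u (k - 1) = (twoDiagOf n X).u (k - 1) →
      (2 ≤ k → ∀ b < (twoDiagOf n X).u (k - 1),
        NextBound k ((n : ℤ) - k + 1) (_root_.forwardStage n X k) b ↔
          b ≤ (twoDiagOf n X).v (k - 1)) →
      (extend k (_root_.forwardStage n X k) (twoDiagOf n X)).Insertable k ((n : ℤ) - k) := by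
    intro k hk hkn h1 h2 h3
    have hu : (extend k (_root_.forwardStage n X k) (twoDiagOf n X)).u (k - 1) =
        (twoDiagOf n X).u (k - 1) := by
      rw [← h2]
      exact (agree_extend (k := k) (k - 1) (by omega)).1.symm
    refine ⟨h1.congr hk agree_extend, ?_, ?_, ?_, ?_, fun hk2 => ?_⟩
    · rw [extend_v]
      exact hX.le_v k hk hkn
    · rw [extend_v, extend_u]
      exact hX.v_le k hk hkn
    · rw [hu, extend_u]
      exact hX.u_le k hk hkn
    · rw [hu, extend_v]
      exact hX.v_lt k hk hkn
    · rw [extend_v]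
      refine NextBound.congr hk2 ((h3 hk2 _ (hX.v_lt k hk hkn)).2 ?_) agree_extend
      have := hX.v_anti (k - 1) (by omega) (by omega)
      rwa [Nat.sub_add_cancel hk] at this
  have hstep : ∀ k, 1 ≤ k → k < n →
      (extend k (_root_.forwardStage n X k) (twoDiagOf n X)).Insertable k ((n : ℤ) - k) →
      Insertion k ((n : ℤ) - k) (extend k (_root_.forwardStage n X k) (twoDiagOf n X))
        (_root_.forwardStage n X (k + 1)) := by
    intro k hk hkn h
    rw [forwardStage_succ hk]
    exact h.insertion_forwardStep hk hkn
  have main : (_root_.forwardStage n X k).Admissible k ((n : ℤ) - k + 1) ∧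
      (_root_.forwardStage n X k).u (k - 1) = (twoDiagOf n X).u (k - 1) ∧
      (2 ≤ k → ∀ b < (twoDiagOf n X).u (k - 1),
        NextBound k ((n : ℤ) - k + 1) (_root_.forwardStage n X k) b ↔
          b ≤ (twoDiagOf n X).v (k - 1)) := by
    induction k, hk using Nat.le_induction with
    | base =>
      have h0 : ∀ i, (_root_.forwardStage n X 1).u i = n := fun _ => rfl
      refine ⟨⟨?_, ?_, ?_, ?_, ?_, ?_, ?_, ?_⟩, ?_, ?_⟩
      · simp [h0]
      · simp [h0]
      · intro i h1 h2
        omega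
      · simp [h0]
      · intro i j h1 h2 h3
        omega
      · intro i h1 h2
        omega
      · intro i h1 h2
        omega
      · intro i j h1 h2 h3
        omega
      · rw [h0, hX.u_zero]
      · intro h
        omega
    | succ k hk ih =>
      obtain ⟨h1, h2, h3⟩ := ih (by omega)
      have hZ := hins k hk hkn h1 h2 h3
      have hI := hstep k hk hkn hZ
      have hA := hI.admissible hk hZ
      have hc : (n : ℤ) - (k + 1 : ℕ) + 1 = n - k := by
        push_cast
        ring
      rw [hc]
      refine ⟨hA, ?_, fun _ b hb => ?_⟩
      · rw [Nat.add_sub_cancel, hI.u_last, extend_u]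
      · rw [Nat.add_sub_cancel] at hb ⊢
        rw [hI.nextBound_iff hA (by rwa [hI.u_last, extend_u]), extend_v]
  exact ⟨main.1, main.2.1, main.2.2,
    fun h => hstep k hk h (hins k hk h main.1 main.2.1 main.2.2)⟩

end TwoDiag

/-! ### Running the inverse algorithm, and inversion of the full algorithms -/

namespace TwoDiag

variable {n k : ℕ} {c : ℤ} {D E : TwoDiag}

theorem backwardStage_eq {X : TriArray} (hk : 1 ≤ k) (hkn : k < n) :
    backwardStage n X (n - k) = backwardStep n k (backwardStage n X (n - (k + 1))) := by
  obtain ⟨m, rfl⟩ := Nat.exists_eq_add_of_lt hkn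
  rw [show k + m + 1 - k = m + 1 by omega, backwardStage,
    show k + m + 1 - (k + 1) = m by omega, show k + m + 1 - (m + 1) = k by omega]

theorem backwardStep_of_lt {i : ℕ} (hi : k < i) :
    (backwardStep n k D).u i = D.u i ∧ (backwardStep n k D).v i = D.v i := by
  have h1 : ¬ i < k := by omega
  have h2 : i ≠ k := by omega
  simp only [backwardStep]
  split_ifs <;> simp [h1, h2]

/-- A step never touches entries beyond its own index, so recorded numbers survive all later steps.
-/
theorem backwardStage_of_le {X : TriArray} {i m : ℕ} (hm : 1 ≤ m) (hmk : m ≤ k) (hki : k ≤ i)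
    (hi : i < n) : (backwardStage n X (n - m)).u i = (backwardStage n X (n - k)).u i ∧
      (backwardStage n X (n - m)).v i = (backwardStage n X (n - k)).v i := by
  induction k, hmk using Nat.le_induction with
  | base => exact ⟨rfl, rfl⟩
  | succ k hmk ih =>
    obtain ⟨h1, h2⟩ := ih (by omega)
    obtain ⟨h3, h4⟩ := backwardStep_of_lt (n := n) (D := backwardStage n X (n - (k + 1)))
      (show k < i by omega)
    rw [← backwardStage_eq (by omega) (by omega)] at h3 h4
    exact ⟨h1.trans h3, h2.trans h4⟩

theorem Admissible.backwardStage {X : TriArray} (hX : (twoDiagOf n X).Admissible n 1)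
    (hk : 1 ≤ k) (hkn : k ≤ n) : (backwardStage n X (n - k)).Admissible k ((n : ℤ) - k + 1) ∧
      (k < n → Insertion k ((n : ℤ) - k) (backwardStage n X (n - k))
        (backwardStage n X (n - (k + 1)))) := by
  have hc : ∀ k : ℕ, (n : ℤ) - (k + 1 : ℕ) + 1 = n - k := fun k => by
    push_cast
    ring
  have main : ∀ m, m < n → (_root_.backwardStage n X m).Admissible (n - m)
      ((n : ℤ) - (n - m : ℕ) + 1) := by
    intro m
    induction m with
    | zero =>
      intro _
      simpa [_root_.backwardStage] using hX
    | succ m ih =>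
      intro hm
      have h1 := ih (by omega)
      rw [show n - m = n - (m + 1) + 1 by omega, hc] at h1
      have h2 := h1.insertion_backwardStep (by omega)
      exact (h2.insertable (by omega) h1).adm
  refine ⟨?_, fun h => ?_⟩
  · have := main (n - k) (by omega)
    rwa [Nat.sub_sub_self hkn] at this
  · have := main (n - (k + 1)) (by omega)
    rw [Nat.sub_sub_self h, hc] at this
    rw [backwardStage_eq hk h]
    exact this.insertion_backwardStep hk

/-- The field `v_anti` compares numbers recorded by two different steps: step `k + 1` supplies
`NextBound`, and `nextBound_iff` for step `k` reads it as an inequality between them. At stage `1`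
admissibility pins `u 0` to `n`. -/
theorem Admissible.isGogPair {X : TriArray} (hn : 2 ≤ n)
    (hX : (twoDiagOf n X).Admissible n 1) : (_root_.backwardStage n X (n - 1)).IsGogPair n := by
  have hA := fun k hk hkn => (hX.backwardStage (k := k) hk hkn).1
  have hI := fun k hk hkn => (hX.backwardStage (k := k) hk (le_of_lt hkn)).2 hkn
  have hA' : ∀ k, 1 ≤ k → k < n → (_root_.backwardStage n X (n - (k + 1))).Admissible (k + 1)
      ((n : ℤ) - k) := fun k hk hkn => by
    have := hA (k + 1) (by omega) hkn
    rwa [show (n : ℤ) - (k + 1 : ℕ) + 1 = n - k by push_cast; ring] at this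
  have hZ := fun k hk hkn => (hI k hk hkn).insertable hk (hA' k hk hkn)
  have hu : ∀ k, 1 ≤ k → k < n → (_root_.backwardStage n X (n - 1)).u k =
      (_root_.backwardStage n X (n - k)).u k :=
    fun k hk hkn => (backwardStage_of_le le_rfl hk le_rfl hkn).1
  have hv : ∀ k, 1 ≤ k → k < n → (_root_.backwardStage n X (n - 1)).v k =
      (_root_.backwardStage n X (n - k)).v k :=
    fun k hk hkn => (backwardStage_of_le le_rfl hk le_rfl hkn).2
  have hu' : ∀ k, 1 ≤ k → k < n → (_root_.backwardStage n X (n - 1)).u (k - 1) =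
      (_root_.backwardStage n X (n - k)).u (k - 1) := by
    intro k hk hkn
    rcases hk.lt_or_eq with h | rfl
    · rw [hu (k - 1) (by omega) (by omega), ← (hI (k - 1) (by omega) (by omega)).u_last,
        Nat.sub_add_cancel hk]
    · rfl
  constructor
  · have h := hA 1 le_rfl (by omega)
    have h1 := h.u_zero
    have h2 := h.u_ge 0 one_pos
    push_cast at h1 h2
    omega
  · intro k hk hkn
    rw [hv k hk hkn]
    exact (hZ k hk hkn).le_v
  · intro k hk hkn
    rw [hv k hk hkn, hu k hk hkn]
    exact (hZ k hk hkn).v_le_u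
  · intro k hk hkn
    rw [hu' k hk hkn, hu k hk hkn]
    exact (hZ k hk hkn).u_le
  · intro k hk hkn
    rw [hu' k hk hkn, hv k hk hkn]
    exact (hZ k hk hkn).v_lt
  · intro k hk hkn
    rw [hv k hk (by omega), hv (k + 1) (by omega) hkn]
    have hZ' := hZ (k + 1) (by omega) hkn
    rw [← (hI k hk (by omega)).nextBound_iff (hA' k hk (by omega)) hZ'.v_lt]
    have := hZ'.bound (by omega)
    rwa [show (n : ℤ) - (k + 1 : ℕ) + 1 = n - k by push_cast; ring] at this

theorem IsGogPair.agree_backwardStage {X Y : TriArray} (hn : 2 ≤ n)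
    (hX : (twoDiagOf n X).IsGogPair n)
    (hY : Agree n (twoDiagOf n Y) (_root_.forwardStage n X n)) :
    Agree n (_root_.backwardStage n Y (n - 1)) (twoDiagOf n X) := by
  have hF := fun k hk hkn => hX.forwardStage (k := k) hk hkn
  have hAY : (twoDiagOf n Y).Admissible n 1 := by
    have := (hF n (by omega) le_rfl).1.congr (by omega) hY.symm
    rwa [sub_self, zero_add] at this
  have hB := fun k hk hkn => hAY.backwardStage (k := k) hk hkn
  have hstep : ∀ k, 1 ≤ k → k < n →
      Agree (k + 1) (_root_.backwardStage n Y (n - (k + 1))) (_root_.forwardStage n X (k + 1)) →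
      Agree (k + 1) (_root_.backwardStage n Y (n - k))
        (extend k (_root_.forwardStage n X k) (twoDiagOf n X)) := by
    intro k hk hkn h
    have hW := (hB (k + 1) (by omega) hkn).1
    rw [show (n : ℤ) - (k + 1 : ℕ) + 1 = n - k by push_cast; ring] at hW
    have hI := ((hF k hk hkn.le).2.2.2 hkn).congr hk (fun i _ => ⟨rfl, fun _ => rfl⟩) h.symm
    rw [backwardStage_eq hk hkn]
    exact hI.agree_backwardStep (hI.insertable hk hW) hW
  have main : ∀ m, m < n →
      Agree (n - m) (_root_.backwardStage n Y m) (_root_.forwardStage n X (n - m)) := by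
    intro m
    induction m with
    | zero => exact fun _ => hY
    | succ m ih =>
      intro hm
      have h := hstep (n - (m + 1)) (by omega) (by omega) (by
        rw [show n - (n - (m + 1) + 1) = m by omega, show n - (m + 1) + 1 = n - m by omega]
        exact ih (by omega))
      rw [Nat.sub_sub_self hm.le] at h
      exact (h.mono (Nat.le_succ _)).trans agree_extend.symm
  have hlast : ∀ k, 1 ≤ k → k < n → Agree (k + 1) (_root_.backwardStage n Y (n - k))
      (extend k (_root_.forwardStage n X k) (twoDiagOf n X)) := by
    intro k hk hkn
    refine hstep k hk hkn ?_
    have := main (n - (k + 1)) (by omega)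
    rwa [Nat.sub_sub_self hkn] at this
  intro i hi
  rcases Nat.eq_zero_or_pos i with rfl | hi0
  · refine ⟨?_, fun h => absurd h (by omega)⟩
    have := main (n - 1) (by omega)
    rw [Nat.sub_sub_self (by omega)] at this
    rw [(this 0 one_pos).1, hX.u_zero]
    rfl
  · obtain ⟨h1, h2⟩ := backwardStage_of_le (X := Y) le_rfl hi0 le_rfl hi
    have := hlast i hi0 hi i (Nat.lt_succ_self i)
    rw [extend_u, extend_v] at this
    exact ⟨h1.trans this.1, fun h => h2.trans (this.2 h)⟩

theorem Admissible.agree_forwardStage {X Y : TriArray} (hn : 2 ≤ n)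
    (hY : (twoDiagOf n Y).Admissible n 1)
    (hX : Agree n (twoDiagOf n X) (_root_.backwardStage n Y (n - 1))) :
    Agree n (_root_.forwardStage n X n) (twoDiagOf n Y) := by
  have hB := fun k hk hkn => hY.backwardStage (k := k) hk hkn
  have main : ∀ k, 1 ≤ k → k ≤ n →
      Agree k (_root_.forwardStage n X k) (_root_.backwardStage n Y (n - k)) := by
    intro k hk
    induction k, hk using Nat.le_induction with
    | base =>
      intro _ i hi
      refine ⟨?_, fun h => absurd h (by omega)⟩
      obtain rfl : i = 0 := by omega
      rw [(hY.isGogPair hn).u_zero]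
      rfl
    | succ k hk ih =>
      intro hkn
      have hW := (hB (k + 1) (by omega) hkn).1
      rw [show (n : ℤ) - (k + 1 : ℕ) + 1 = n - k by push_cast; ring] at hW
      obtain ⟨h1, h2⟩ := backwardStage_of_le (X := Y) le_rfl hk le_rfl hkn
      obtain ⟨h3, h4⟩ := hX k hkn
      have hZ := (ih (by omega)).extend_left (E := twoDiagOf n X) (h3.trans h1)
        ((h4 hk).trans h2)
      rw [forwardStage_succ hk]
      exact (((hB k hk (by omega)).2 hkn).congr hk hZ.symm
        (fun i _ => ⟨rfl, fun _ => rfl⟩)).agree_forwardStep hk hkn hW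
  have := main n (by omega) le_rfl
  rwa [Nat.sub_self] at this

end TwoDiag

/-! ### The Schützenberger involution on triangles with two free diagonals -/

theorem sOp_of_ne {k i : ℕ} (X : TriArray) (j : ℕ) (h : i ≠ k) : sOp k X i j = X i j := by
  simp [sOp, h]

theorem sOp_self {k j : ℕ} (X : TriArray) (h1 : 1 ≤ j) (hj : j ≤ k) : sOp k X k j =
    (if j = 1 then X (k + 1) j else max (X (k + 1) j) (X (k - 1) (j - 1))) +
      (if j = k then X (k + 1) (j + 1) else min (X (k + 1) (j + 1)) (X (k - 1) j)) - X k j :=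
  if_pos ⟨rfl, h1, hj⟩

theorem sOp_involutive (k : ℕ) : Function.Involutive (sOp k) := by
  intro X
  funext i j
  by_cases h : i = k ∧ 1 ≤ j ∧ j ≤ k
  · obtain ⟨rfl, h1, h2⟩ := h
    have h3 : i - 1 ≠ i := by omega
    have h4 : i + 1 ≠ i := by omega
    rw [sOp_self _ h1 h2, sOp_self _ h1 h2]
    simp only [sOp_of_ne _ _ h3, sOp_of_ne _ _ h4]
    ring
  · simp only [sOp, if_neg h]

theorem IsGelfandTsetlin.sOp_bounds {n k j : ℕ} {X : TriArray} (hX : IsGelfandTsetlin n X)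
    (h1 : 1 ≤ j) (hj : j ≤ k) (hk : k < n) :
    X (k + 1) j ≤ sOp k X k j ∧ sOp k X k j ≤ X (k + 1) (j + 1) ∧
      (j ≠ 1 → X (k - 1) (j - 1) ≤ sOp k X k j) ∧ (j ≠ k → sOp k X k j ≤ X (k - 1) j) := by
  have a1 := hX.left k j h1 hj hk
  have a2 := hX.right k j h1 hj hk
  have a3 : j ≠ 1 → X (k - 1) (j - 1) ≤ X k j := fun h => by
    have := hX.right (k - 1) (j - 1) (by omega) (by omega) (by omega)
    rwa [Nat.sub_add_cancel h1, Nat.sub_add_cancel (h1.trans hj)] at this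
  have a4 : j ≠ k → X k j ≤ X (k - 1) j := fun h => by
    have := hX.left (k - 1) j h1 (by omega) (by omega)
    rwa [Nat.sub_add_cancel (h1.trans hj)] at this
  rw [sOp_self _ h1 hj]
  split_ifs with h h' h'
  · subst h h'
    refine ⟨?_, ?_, fun h => absurd rfl h, fun h => absurd rfl h⟩ <;> omega
  · have := a4 h'
    refine ⟨?_, ?_, fun h' => absurd h h', fun _ => ?_⟩ <;> omega
  · have := a3 h
    refine ⟨?_, ?_, fun _ => ?_, fun h => absurd h' h⟩ <;> omega
  · have := a3 h
    have := a4 h'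
    refine ⟨?_, ?_, fun _ => ?_, fun _ => ?_⟩ <;> omega

theorem IsGelfandTsetlin.sOp {n k : ℕ} {X : TriArray} (hX : IsGelfandTsetlin n X) (hk : k < n) :
    IsGelfandTsetlin n (sOp k X) := by
  have hb := fun j h1 hj => hX.sOp_bounds (k := k) (j := j) h1 hj hk
  constructor
  · intro i j h1 h2 h3
    by_cases h : i = k
    · subst h
      exact (hX.pos _ _ h1 (by omega) (by omega)).trans_le (hb j h1 h2).1
    · rw [sOp_of_ne _ _ h]
      exact hX.pos i j h1 h2 h3
  · intro i j h
    rw [_root_.sOp, if_neg (by omega)]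
    exact hX.zero i j h
  · intro i j h1 h2 h3
    by_cases h : i = k
    · subst h
      rw [sOp_of_ne _ _ (by omega)]
      exact (hb j h1 h2).1
    · rw [sOp_of_ne _ _ h]
      by_cases h' : i + 1 = k
      · subst h'
        exact (hb j h1 (by omega)).2.2.2 (by omega)
      · rw [sOp_of_ne _ _ h']
        exact hX.left i j h1 h2 h3
  · intro i j h1 h2 h3
    by_cases h : i = k
    · subst h
      rw [sOp_of_ne _ _ (show i + 1 ≠ i by omega)]
      exact (hb j h1 h2).2.1
    · rw [sOp_of_ne _ _ h]
      by_cases h' : i + 1 = k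
      · subst h'
        exact (hb (j + 1) (by omega) (by omega)).2.2.1 (by omega)
      · rw [sOp_of_ne _ _ h']
        exact hX.right i j h1 h2 h3

theorem isGelfandTsetlin_sOp {n k : ℕ} {X : TriArray} (hk : k < n) :
    IsGelfandTsetlin n (sOp k X) ↔ IsGelfandTsetlin n X :=
  ⟨fun h => by simpa only [sOp_involutive k X] using h.sOp hk, fun h => h.sOp hk⟩

theorem isGelfandTsetlin_omegaOp {n m : ℕ} {X : TriArray} (hm : m < n) :
    IsGelfandTsetlin n (omegaOp m X) ↔ IsGelfandTsetlin n X := by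
  induction m with
  | zero => rfl
  | succ m ih => rw [omegaOp, Function.comp_apply, isGelfandTsetlin_sOp hm, ih (by omega)]

theorem omegaOp_of_lt {m i : ℕ} (X : TriArray) (j : ℕ) (h : m < i) :
    omegaOp m X i j = X i j := by
  induction m with
  | zero => rfl
  | succ m ih => rw [omegaOp, Function.comp_apply, sOp_of_ne _ _ h.ne', ih (by omega)]

theorem omegaOp_bijective (m : ℕ) : Function.Bijective (omegaOp m) := by
  induction m with
  | zero => exact Function.bijective_id
  | succ m ih => exact (sOp_involutive (m + 1)).bijective.comp ih

theorem isGelfandTsetlin_omegaProd {n m : ℕ} {X : TriArray} (hm : m < n) :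
    IsGelfandTsetlin n (omegaProd m X) ↔ IsGelfandTsetlin n X := by
  induction m generalizing X with
  | zero => rfl
  | succ m ih =>
    rw [omegaProd, Function.comp_apply, ih (by omega), isGelfandTsetlin_omegaOp hm]

theorem omegaProd_of_lt {m i : ℕ} (X : TriArray) (j : ℕ) (h : m < i) :
    omegaProd m X i j = X i j := by
  induction m generalizing X with
  | zero => rfl
  | succ m ih => rw [omegaProd, Function.comp_apply, ih _ (by omega), omegaOp_of_lt _ _ h]

theorem omegaProd_bijective (m : ℕ) : Function.Bijective (omegaProd m) := by
  induction m with
  | zero => exact Function.bijective_id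
  | succ m ih => exact ih.comp (omegaOp_bijective (m + 1))

/-- In a Gelfand-Tsetlin triangle the trapezoid condition for `1`s concerns the last row only. -/
theorem IsGelfandTsetlin.trapezoid_iff {n k : ℕ} {X : TriArray} (hX : IsGelfandTsetlin n X) :
    (∀ i j, 1 ≤ j → j ≤ i → i ≤ n → j + k ≤ i → X i j = 1) ↔
      ∀ j, 1 ≤ j → j + k ≤ n → X n j = 1 := by
  refine ⟨fun h j h1 hj => h n j h1 (by omega) le_rfl hj, fun h i j h1 hj hi hij => ?_⟩
  obtain ⟨m, hm⟩ := Nat.exists_eq_add_of_le hi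
  induction m generalizing i j with
  | zero =>
    obtain rfl : n = i := hm
    exact h j h1 hij
  | succ m ih =>
    have h' := ih (i + 1) (j + 1) (by omega) (by omega) (by omega) (by omega) (by omega)
    have h2 := hX.right i j h1 hj (by omega)
    have h3 := hX.pos i j h1 hj (by omega)
    omega

/-- Bijectivity of each `s_k` on all arrays suffices; that `S` is an involution plays no role. The
trapezoid condition is transported because `S` fixes row `n`. -/
theorem bijOn_schutzenberger {n k : ℕ} (hn : 1 ≤ n) :
    Set.BijOn (schutzenberger n) (gogamTrapezoids n k) (magogTrapezoids n k) := by
  have hb := omegaProd_bijective (n - 1)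
  have hrow : ∀ X j, schutzenberger n X n j = X n j :=
    fun X j => omegaProd_of_lt X j (show n - 1 < n by omega)
  refine ⟨fun X hX => ⟨hX.1.magog, ?_⟩, hb.injective.injOn, fun Y hY => ?_⟩
  · rw [hX.1.magog.gt.trapezoid_iff]
    simp only [hrow]
    exact hX.1.gt.trapezoid_iff.1 hX.2
  · obtain ⟨X, rfl⟩ := hb.surjective Y
    have hX : IsGelfandTsetlin n X := (isGelfandTsetlin_omegaProd (by omega)).1 hY.1.gt
    refine ⟨X, ⟨⟨hX, hY.1⟩, ?_⟩, rfl⟩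
    rw [hX.trapezoid_iff]
    intro j h1 hj
    rw [← hrow X j]
    exact hY.1.gt.trapezoid_iff.1 hY.2 j h1 hj

/-! ### The diagonal entries of `SX` -/

/-- The last entry of row `k`, extended by `1` to the empty row. -/
def lastEntry (X : TriArray) (k : ℕ) : ℤ := if k = 0 then 1 else X k k

/-- The last but one entry of row `k`, extended by `1` to the shorter rows. -/
def lastButOneEntry (X : TriArray) (k : ℕ) : ℤ := if k ≤ 1 then 1 else X k (k - 1)

/-- The maximum of `A (r + 1), …, A (r + k + 1)`. -/
def runMax (A : ℕ → ℤ) (r : ℕ) : ℕ → ℤ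
  | 0 => A (r + 1)
  | k + 1 => max (runMax A r k) (A (r + k + 2))

theorem runMax_succ_left (A : ℕ → ℤ) (r k : ℕ) :
    runMax A r (k + 1) = max (A (r + 1)) (runMax A (r + 1) k) := by
  induction k with
  | zero => rfl
  | succ k ih =>
    rw [runMax, ih, runMax, max_assoc]
    congr 3
    omega

theorem runMax_le_iff {A : ℕ → ℤ} {r k : ℕ} {z : ℤ} :
    runMax A r k ≤ z ↔ ∀ j, r < j → j ≤ r + k + 1 → A j ≤ z := by
  induction k with
  | zero =>
    refine ⟨fun h j h1 h2 => ?_, fun h => h _ (by omega) (by omega)⟩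
    obtain rfl : j = r + 1 := by omega
    exact h
  | succ k ih =>
    rw [runMax, max_le_iff, ih]
    refine ⟨fun h j h1 h2 => ?_, fun h => ⟨fun j h1 h2 => h j h1 (by omega),
      h _ (by omega) (by omega)⟩⟩
    rcases (show j ≤ r + k + 1 + 1 by omega).lt_or_eq with h' | rfl
    · exact h.1 j h1 (by omega)
    · exact h.2

/-- The rows `1, …, m` of `Y` are the shapes with at most two rows that are obtained by rectifying
the skew tableaux between the rows `r` and `r + k` of a tableau with row data `p`, `q`. -/
structure IsRectified (p q : ℕ → ℤ) (r m : ℕ) (Y : TriArray) : Prop where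
  last : ∀ k, k < m → lastEntry Y (k + 1) =
    1 + runMax (fun j => q j - p (j - 1)) r k + p (r + k + 1) - q r
  sum : ∀ k, k < m → lastEntry Y (k + 1) + lastButOneEntry Y (k + 1) =
    p (r + k + 1) + q (r + k + 1) - p r - q r + 2

theorem lastEntry_sOp {k : ℕ} (Y : TriArray) : lastEntry (sOp (k + 1) Y) (k + 1) =
    (if k = 0 then lastButOneEntry Y (k + 2) else max (lastButOneEntry Y (k + 2)) (lastEntry Y k))
      + lastEntry Y (k + 2) - lastEntry Y (k + 1) := by
  rcases Nat.eq_zero_or_pos k with rfl | hk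
  · simp [lastEntry, lastButOneEntry, sOp]
  · simp [lastEntry, lastButOneEntry, sOp, hk.ne']

/-- By `h1` the neighbour from row `k + 2` has the least possible value `1`, so the maximum reduces
to the neighbour from row `k`. -/
theorem lastButOneEntry_sOp {k n : ℕ} {Y : TriArray} (hY : IsGelfandTsetlin n Y)
    (hk : k + 1 < n) (h1 : k ≠ 0 → Y (k + 2) k = 1) :
    lastButOneEntry (sOp (k + 1) Y) (k + 1) = lastButOneEntry Y k +
      (if k = 0 then 1 else min (lastButOneEntry Y (k + 2)) (lastEntry Y k)) -
        lastButOneEntry Y (k + 1) := by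
  rcases k with _ | _ | k
  · simp [lastButOneEntry]
  · have := h1 (by omega)
    simp [lastEntry, lastButOneEntry, sOp, this]
  · have := h1 (by omega)
    have h2 := hY.pos (k + 2) (k + 1) (by omega) (by omega) (by omega)
    simp [lastEntry, lastButOneEntry, sOp, this]
    exact h2

/-- Induction on the row: row `j + 1` is reflected between row `j`, already rectified from `r + 1`,
and row `j + 2`, still rectified from `r`. Splitting off the first and last terms of the maxima
leaves a common inner maximum and a piecewise linear identity. -/
theorem omegaOp_rectified {p q : ℕ → ℤ} {r m n : ℕ} {Y : TriArray} (hY : IsGelfandTsetlin n Y)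
    (hm : m ≤ n) (h1 : ∀ k, 1 ≤ k → k + 2 ≤ n → Y (k + 2) k = 1)
    (hR : IsRectified p q r m Y) (j : ℕ) (hj : j < m) :
    IsRectified p q (r + 1) j (omegaOp j Y) := by
  induction j with
  | zero => exact ⟨fun k hk => absurd hk (by omega), fun k hk => absurd hk (by omega)⟩
  | succ j ih =>
    have ih := ih (by omega)
    have hG := (isGelfandTsetlin_omegaOp (n := n) (m := j) (by omega)).2 hY
    set Z := omegaOp j Y with hZ
    have hZY : ∀ i, j < i → lastEntry Z i = lastEntry Y i ∧
        lastButOneEntry Z i = lastButOneEntry Y i := fun i hi => by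
      simp only [lastEntry, lastButOneEntry, hZ, omegaOp_of_lt _ _ hi, and_self]
    obtain ⟨e1, e2⟩ := hZY (j + 1) (by omega)
    obtain ⟨e3, e4⟩ := hZY (j + 2) (by omega)
    have l1 := hR.last j (by omega)
    have l2 : lastEntry Y (j + 2) = 1 + runMax (fun j => q j - p (j - 1)) r (j + 1) +
        p (r + j + 2) - q r := hR.last (j + 1) (by omega)
    have s1 := hR.sum j (by omega)
    have s2 : lastEntry Y (j + 2) + lastButOneEntry Y (j + 2) =
        p (r + j + 2) + q (r + j + 2) - p r - q r + 2 := hR.sum (j + 1) (by omega)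
    have hold : ∀ k, k < j → lastEntry (omegaOp (j + 1) Y) (k + 1) = lastEntry Z (k + 1) ∧
        lastButOneEntry (omegaOp (j + 1) Y) (k + 1) = lastButOneEntry Z (k + 1) := by
      intro k hk
      simp only [lastEntry, lastButOneEntry, omegaOp, Function.comp_apply,
        sOp_of_ne _ _ (show k + 1 ≠ j + 1 by omega), ← hZ, and_self]
    have hlast := lastEntry_sOp (k := j) Z
    have hsnd := lastButOneEntry_sOp (k := j) hG (by omega) fun h => by
      rw [hZ, omegaOp_of_lt _ _ (by omega)]
      exact h1 j (by omega) (by omega)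
    rw [e1, e3, e4] at hlast
    rw [e2, e4] at hsnd
    have hnew : lastEntry (sOp (j + 1) Z) (j + 1) =
        1 + runMax (fun j => q j - p (j - 1)) (r + 1) j + p (r + 1 + j + 1) - q (r + 1) ∧
        lastEntry (sOp (j + 1) Z) (j + 1) + lastButOneEntry (sOp (j + 1) Z) (j + 1) =
        p (r + 1 + j + 1) + q (r + 1 + j + 1) - p (r + 1) - q (r + 1) + 2 := by
      rw [show r + 1 + j + 1 = r + j + 2 by omega]
      rcases Nat.eq_zero_or_pos j with rfl | hj0
      · have b0 : lastButOneEntry Z 0 = 1 := rfl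
        have b1 : lastButOneEntry Y 1 = 1 := rfl
        simp only [if_true, runMax, Nat.add_sub_cancel, zero_add, add_zero] at *
        rw [show r + 1 + 1 = r + 2 from rfl]
        rw [show r + 2 - 1 = r + 1 from rfl] at l2
        constructor <;> omega
      · obtain ⟨i, rfl⟩ := Nat.exists_eq_add_of_le' (show 1 ≤ j from hj0)
        simp only [if_neg hj0.ne'] at hlast hsnd
        have l3 := ih.last i (by omega)
        have s3 := ih.sum i (by omega)
        rw [show r + 1 + i + 1 = r + (i + 1) + 1 by omega] at l3 s3
        rw [runMax, runMax_succ_left] at l2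
        rw [runMax_succ_left] at l1
        rw [runMax, show r + 1 + i + 2 = r + (i + 1) + 2 by omega]
        rw [show r + (i + 1) + 2 - 1 = r + (i + 1) + 1 from rfl] at l2 ⊢
        simp only [Nat.add_sub_cancel] at l1 l2
        constructor <;> omega
    constructor
    · intro k hk
      rcases (Nat.lt_succ_iff.1 hk).lt_or_eq with h | rfl
      · rw [(hold k h).1]
        exact ih.last k h
      · exact hnew.1
    · intro k hk
      rcases (Nat.lt_succ_iff.1 hk).lt_or_eq with h | rfl
      · rw [(hold k h).1, (hold k h).2]
        exact ih.sum k h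
      · exact hnew.2

/-- The factors `ω_j` with `j ≤ k` do not change row `k + 1`, so its last entry can be read off as
soon as `r = n - (k + 1)`. -/
theorem lastEntry_omegaProd {p q : ℕ → ℤ} {m n r : ℕ} {Y : TriArray} (hY : IsGelfandTsetlin n Y)
    (hm : m < n) (hr : r + m + 1 = n) (h1 : ∀ j, 1 ≤ j → j + 2 ≤ n → Y n j = 1)
    (hR : IsRectified p q r (m + 1) Y) (k : ℕ) (hk : k ≤ m) :
    lastEntry (omegaProd m Y) (k + 1) =
      1 + runMax (fun j => q j - p (j - 1)) (n - (k + 1)) k + p n - q (n - (k + 1)) := by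
  induction m generalizing Y r with
  | zero =>
    obtain rfl : k = 0 := by omega
    have := hR.last 0 (by omega)
    subst hr
    exact this
  | succ m ih =>
    rcases hk.lt_or_eq with h | rfl
    · have hG := (isGelfandTsetlin_omegaOp (n := n) (m := m + 1) (by omega)).2 hY
      refine ih (r := r + 1) hG (by omega) (by omega) (fun j hj hjn => ?_) ?_ (by omega)
      · rw [omegaOp_of_lt _ _ (by omega)]
        exact h1 j hj hjn
      · exact omegaOp_rectified hY (by omega)
          (fun k hk hkn => (hY.trapezoid_iff (k := 2)).2 h1 (k + 2) k hk (by omega) hkn le_rfl)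
          hR (m + 1) (by omega)
    · have := hR.last (m + 1) (by omega)
      rw [show n - (m + 1 + 1) = r by omega, show n = r + (m + 1) + 1 by omega, ← this]
      simp only [lastEntry]
      rw [omegaProd_of_lt _ _ (by omega)]

theorem lastEntry_schutzenberger {n k : ℕ} {X : TriArray} (hX : IsGelfandTsetlin n X)
    (h1 : ∀ j, 1 ≤ j → j + 2 ≤ n → X n j = 1) (hk : k < n) :
    schutzenberger n X (k + 1) (k + 1) =
      1 + runMax (fun j => lastButOneEntry X j - lastEntry X (j - 1)) (n - (k + 1)) k +
        lastEntry X n - lastButOneEntry X (n - (k + 1)) := by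
  refine lastEntry_omegaProd (r := 0) hX (by omega) (by omega) h1 ⟨fun k hk => ?_, fun k hk => ?_⟩
    k (by omega)
  -- The default values make the term `j = 1` zero, and interlacing makes the others nonpositive:
  -- starting at `r = 0` there is nothing to rectify.
  · have : runMax (fun j => lastButOneEntry X j - lastEntry X (j - 1)) 0 k = 0 := by
      refine le_antisymm (runMax_le_iff.2 fun j h1 h2 => ?_) ?_
      · simp only [lastButOneEntry, lastEntry]
        rcases (show 1 ≤ j by omega).lt_or_eq with h | rfl
        · have := hX.left (j - 1) (j - 1) (by omega) le_rfl (by omega)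
          rw [Nat.sub_add_cancel (by omega)] at this
          rw [if_neg (by omega), if_neg (by omega)]
          omega
        · simp
      · exact runMax_le_iff.1 le_rfl 1 one_pos (by omega)
    rw [this]
    simp [lastButOneEntry]
  · simp only [lastEntry, lastButOneEntry]
    simp
    ring

/-! ### Trapezoids in terms of their two free diagonals -/

theorem IsGelfandTsetlin.eq_triangleOf {n : ℕ} {c : ℕ → ℤ} {X : TriArray}
    (hX : IsGelfandTsetlin n X) (h : ∀ i j, 1 ≤ j → j ≤ i → i ≤ n → j + 2 ≤ i → X i j = c j) :
    triangleOf n c (twoDiagOf n X) = X := by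
  funext i j
  simp only [triangleOf, twoDiagOf]
  split_ifs with h1 h2 h3
  · obtain rfl := h2
    rw [Nat.sub_sub_self h1.2.2]
  · rw [Nat.sub_sub_self (by omega), h3]
  · exact (h i j h1.1 h1.2.1 h1.2.2 (by omega)).symm
  · exact (hX.zero i j h1).symm

/-- With `i = n - j + 1`, the term `j` of the bound for row `k + 1` is `two` at `(i, k + 2)`. In row
`n - 1` the default `1` takes the place of `v (k + 2)` and gives `one`; in row `n` the term `j = 1`
gives `u_zero`, and the others are weaker than `one`. -/
theorem magog_schutzenberger_iff {n : ℕ} {X : TriArray} (hX : IsGelfandTsetlin n X)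
    (h1 : ∀ j, 1 ≤ j → j + 2 ≤ n → X n j = 1) (hn : 2 ≤ n) :
    IsMagog n (schutzenberger n X) ↔ (twoDiagOf n X).Admissible n 1 := by
  have hlast : (∀ k, k < n → schutzenberger n X (k + 1) (k + 1) ≤ (k + 1 : ℕ)) ↔
      ∀ k, k < n → ∀ j, n - (k + 1) < j → j ≤ n → 1 + (lastButOneEntry X j -
        lastEntry X (j - 1)) + lastEntry X n - lastButOneEntry X (n - (k + 1)) ≤ (k + 1 : ℕ) := by
    refine forall₂_congr fun k hk => ?_
    rw [lastEntry_schutzenberger hX h1 hk, ← sub_nonneg]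
    have := runMax_le_iff (A := fun j => lastButOneEntry X j - lastEntry X (j - 1))
      (r := n - (k + 1)) (k := k) (z := (k + 1 : ℕ) - 1 - lastEntry X n +
        lastButOneEntry X (n - (k + 1)))
    rw [show n - (k + 1) + k + 1 = n by omega] at this
    rw [show ∀ a : ℤ, (0 ≤ ((k + 1 : ℕ) : ℤ) - (1 + a + lastEntry X n -
      lastButOneEntry X (n - (k + 1))) ↔ a ≤ (k + 1 : ℕ) - 1 - lastEntry X n +
        lastButOneEntry X (n - (k + 1))) from fun a => by constructor <;> intro h <;> omega, this]
    refine forall₃_congr fun j _ _ => ?_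
    constructor <;> intro h <;> omega
  have hu : ∀ i, i < n → (twoDiagOf n X).u i = lastEntry X (n - i) := fun i hi => by
    rw [lastEntry, if_neg (by omega), twoDiagOf]
  have hv : ∀ i, 1 ≤ i → i < n → (twoDiagOf n X).v i = lastButOneEntry X (n - i + 1) :=
    fun i h1 hi => by rw [lastButOneEntry, if_neg (by omega), twoDiagOf, Nat.add_sub_cancel]
  obtain ⟨g1, g2, g3, g4, g5⟩ := hX.twoDiag
  have q0 : lastButOneEntry X 0 = 1 := rfl
  have q1 : lastButOneEntry X 1 = 1 := rfl
  constructor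
  · intro h
    have hd := hlast.1 fun k hk => h.diag (k + 1) (by omega) (by omega)
    refine ⟨?_, g1, g2, ?_, ?_, g5, fun i hi hin => ?_, fun i j hi hij hjn => ?_⟩
    · have := hd (n - 1) (by omega) 1 (by omega) (by omega)
      rw [show n - (n - 1 + 1) = 0 by omega] at this
      rw [hu 0 (by omega), Nat.sub_zero]
      have p0 : lastEntry X (1 - 1) = 1 := rfl
      omega
    · intro i j hij hj
      induction j, hij using Nat.le_induction with
      | base => exact le_rfl
      | succ j hij ih => exact (g3 j hj).trans (ih (by omega))
    · intro i j hi hij hj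
      induction j, hij using Nat.le_induction with
      | base => exact le_rfl
      | succ j hij ih => exact (g4 j (by omega) hj).trans (ih (by omega))
    · have := hd (n - 2) (by omega) (n - i + 1) (by omega) (by omega)
      rw [show n - (n - 2 + 1) = 1 by omega, Nat.add_sub_cancel] at this
      rw [hu 0 (by omega), hu i hin, hv i hi hin, Nat.sub_zero]
      omega
    · have := hd (j - 2) (by omega) (n - i + 1) (by omega) (by omega)
      rw [show n - (j - 2 + 1) = n - j + 1 by omega, Nat.add_sub_cancel] at this
      rw [hu 0 (by omega), hu i (by omega), hv i hi (by omega), hv j (by omega) hjn, Nat.sub_zero]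
      omega
  · intro h
    refine ⟨(isGelfandTsetlin_omegaProd (by omega)).2 hX, fun i hi hin => ?_⟩
    obtain ⟨i, rfl⟩ := Nat.exists_eq_add_of_le' hi
    refine hlast.2 (fun k hk j hkj hj => ?_) i hin
    have hu0 := hu 0 (by omega)
    rw [Nat.sub_zero] at hu0
    have hz := h.u_zero
    have hone := fun hj2 : 2 ≤ j => h.one (n - j + 1) (by omega) (by omega)
    have hui := fun hj2 : 2 ≤ j => hu (n - j + 1) (by omega)
    have hvi := fun hj2 : 2 ≤ j => hv (n - j + 1) (by omega) (by omega)
    rcases Nat.lt_or_ge j 2 with hj2 | hj2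
    · obtain rfl : j = 1 := by omega
      have p0 : lastEntry X (1 - 1) = 1 := rfl
      rw [show n - (k + 1) = 0 by omega]
      omega
    · have hone := hone hj2
      have hui := hui hj2
      have hvi := hvi hj2
      rw [show n - (n - j + 1) = j - 1 by omega] at hui hvi
      rw [Nat.sub_add_cancel (by omega)] at hvi
      rcases Nat.lt_or_ge (k + 2) n with hk2 | hk2
      · have htwo := h.two (n - j + 1) (k + 2) (by omega) (by omega) hk2
        have hvk := hv (k + 2) (by omega) hk2
        rw [show n - (k + 2) + 1 = n - (k + 1) by omega] at hvk
        omega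
      · rcases hk2.lt_or_eq with hk2 | hk2
        · rw [show n - (k + 1) = 0 by omega]
          omega
        · rw [show n - (k + 1) = 1 by omega]
          omega

theorem mem_gogamTrapezoids_iff {n : ℕ} (hn : 2 ≤ n) {X : TriArray} :
    X ∈ gogamTrapezoids n 2 ↔
      (twoDiagOf n X).Admissible n 1 ∧ triangleOf n (fun _ => 1) (twoDiagOf n X) = X := by
  constructor
  · rintro ⟨h, h1⟩
    exact ⟨(magog_schutzenberger_iff h.gt (h.gt.trapezoid_iff.1 h1) hn).1 h.magog,
      h.gt.eq_triangleOf h1⟩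
  · rintro ⟨h, hX⟩
    have hG : IsGelfandTsetlin n X := by
      rw [← hX]
      exact isGelfandTsetlin_triangleOf one_pos h.u_ge h.v_ge
        (fun i hi => h.u_anti i (i + 1) (by omega) hi)
        (fun i h1 hi => h.v_anti i (i + 1) h1 (by omega) hi) h.v_le
    have h1 : ∀ i j, 1 ≤ j → j ≤ i → i ≤ n → j + 2 ≤ i → X i j = 1 := by
      intro i j h1 h2 h3 h4
      rw [← hX, triangleOf, if_pos ⟨h1, h2, h3⟩, if_neg (by omega), if_neg (by omega)]
    exact ⟨⟨hG, (magog_schutzenberger_iff hG (hG.trapezoid_iff.1 h1) hn).2 h⟩, h1⟩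

theorem isGogPair_of_mem {n : ℕ} (hn : 2 ≤ n) {X : TriArray} (h : X ∈ gogTrapezoids n 2) :
    (twoDiagOf n X).IsGogPair n := by
  obtain ⟨⟨hG, hs, ht⟩, h1⟩ := h
  obtain ⟨g1, g2, g3, g4, g5⟩ := hG.twoDiag
  have hge : ∀ i j, 1 ≤ j → j ≤ i → i ≤ n → (j : ℤ) ≤ X i j := by
    intro i j h1 h2 h3
    induction j, h1 using Nat.le_induction generalizing i with
    | base => exact hG.pos i 1 le_rfl h2 h3
    | succ j hj ih =>
      rcases h3.lt_or_eq with h3 | rfl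
      · have := hs i j hj h2 (by omega)
        have := ih i (by omega) h3.le
        push_cast
        omega
      · exact (ht (j + 1) (by omega) h2).ge
  have hu0 : (twoDiagOf n X).u 0 = n := ht n (by omega) le_rfl
  refine ⟨hu0, fun k hk hkn => ?_, g5, fun k hk hkn => ?_, fun k hk hkn => ?_, g4⟩
  · have := hge (n - k + 1) (n - k) (by omega) (by omega) (by omega)
    rwa [Nat.cast_sub hkn.le] at this
  · have := g3 (k - 1) (by omega)
    rwa [Nat.sub_add_cancel hk] at this
  · rcases hk.lt_or_eq with h | rfl
    · have := hs (n - k + 1) (n - k) (by omega) (by omega) (by omega)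
      simp only [twoDiagOf]
      rwa [show n - (k - 1) = n - k + 1 by omega]
    · rw [hu0]
      simp only [twoDiagOf]
      rw [Nat.sub_add_cancel (by omega), ht (n - 1) (by omega) (by omega)]
      omega

theorem TwoDiag.IsGogPair.mem {n : ℕ} (hn : 2 ≤ n) {D : TwoDiag} (h : D.IsGogPair n) :
    triangleOf n (fun j => (j : ℤ)) D ∈ gogTrapezoids n 2 := by
  -- This is the entry of the top row on the second diagonal, squeezed between `le_v` and `v_lt`.
  have hv1 : D.v 1 = (n : ℤ) - 1 := by
    have := h.le_v 1 le_rfl hn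
    have := h.v_lt 1 le_rfl hn
    have := h.u_zero
    simp only [Nat.sub_self] at *
    push_cast at *
    omega
  have hu : ∀ k, k < n → (n : ℤ) - k ≤ D.u k := by
    intro k hk
    rcases Nat.eq_zero_or_pos k with rfl | h0
    · simp [h.u_zero]
    · exact (h.le_v k h0 hk).trans (h.v_le k h0 hk)
  have hu' : ∀ i, 1 ≤ i → i ≤ n → (i : ℤ) ≤ D.u (n - i) := fun i hi hin => by
    have := hu (n - i) (by omega)
    rw [Nat.cast_sub hin] at this
    omega
  have hv' : ∀ j, 1 ≤ j → j < n → (j : ℤ) ≤ D.v (n - j) := fun i hi hin => by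
    have := h.le_v (n - i) (by omega) (by omega)
    rw [Nat.cast_sub hin.le] at this
    omega
  refine ⟨⟨⟨?_, ?_, ?_, ?_⟩, ?_, ?_⟩, ?_⟩
  · intro i j h1 h2 h3
    simp only [triangleOf, if_pos (And.intro h1 (And.intro h2 h3))]
    split_ifs with e e'
    · have := hu' i (by omega) h3
      omega
    · have := hv' j (by omega) (by omega)
      omega
    · omega
  · intro i j h
    simp only [triangleOf, if_neg h]
  · intro i j h1 h2 h3
    simp only [triangleOf, if_pos (show 1 ≤ j ∧ j ≤ i + 1 ∧ i + 1 ≤ n by omega),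
      if_pos (show 1 ≤ j ∧ j ≤ i ∧ i ≤ n by omega)]
    rcases h2.lt_or_eq with e | rfl
    · rw [if_neg (by omega), if_neg (by omega), if_neg (by omega)]
      split_ifs with e'
      · exact hv' j h1 (by omega)
      · exact le_rfl
    · rw [if_neg (by omega), if_pos rfl, if_pos rfl]
      exact h.v_le _ (by omega) (by omega)
  · intro i j h1 h2 h3
    simp only [triangleOf, if_pos (show 1 ≤ j + 1 ∧ j + 1 ≤ i + 1 ∧ i + 1 ≤ n by omega),
      if_pos (show 1 ≤ j ∧ j ≤ i ∧ i ≤ n by omega), Nat.add_right_cancel_iff]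
    split_ifs with e e'
    · have := h.u_le (n - i) (by omega) (by omega)
      rwa [show n - i - 1 = n - (i + 1) by omega] at this
    · have := h.v_anti (n - (j + 1)) (by omega) (by omega)
      rwa [show n - (j + 1) + 1 = n - j by omega] at this
    · push_cast
      omega
  · intro i j h1 h2 h3
    simp only [triangleOf, if_pos (show 1 ≤ j ∧ j ≤ i ∧ i ≤ n by omega),
      if_pos (show 1 ≤ j + 1 ∧ j + 1 ≤ i ∧ i ≤ n by omega)]
    rw [if_neg (by omega)]
    rcases (show i = j + 1 ∨ i = j + 2 ∨ j + 2 < i by omega) with rfl | rfl | e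
    · rw [if_pos rfl, if_pos rfl]
      have := h.v_lt (n - j) (by omega) (by omega)
      rwa [show n - j - 1 = n - (j + 1) by omega] at this
    · rw [if_neg (by omega), if_neg (by omega), if_pos rfl]
      have := hv' (j + 1) (by omega) (by omega)
      push_cast at this
      omega
    · rw [if_neg (by omega), if_neg (by omega), if_neg (by omega)]
      push_cast
      omega
  · intro j h1 h2
    simp only [triangleOf, if_pos (show 1 ≤ j ∧ j ≤ n ∧ n ≤ n from ⟨h1, h2, le_rfl⟩)]
    split_ifs with e e'
    · rw [Nat.sub_self, h.u_zero, e]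
    · rw [show n - j = 1 by omega, hv1]
      omega
    · rfl
  · intro i j h1 h2 h3 h4
    rw [triangleOf, if_pos ⟨h1, h2, h3⟩, if_neg (by omega), if_neg (by omega)]

theorem gogTrapezoid_eq_triangleOf {n : ℕ} {X : TriArray} (h : X ∈ gogTrapezoids n 2) :
    triangleOf n (fun j => (j : ℤ)) (twoDiagOf n X) = X :=
  h.1.gt.eq_triangleOf h.2

/-! ### The bijection between Gog and GOGAm trapezoids -/

theorem mapsTo_gogToGogam {n : ℕ} (hn : 2 ≤ n) :
    Set.MapsTo (gogToGogam n) (gogTrapezoids n 2) (gogamTrapezoids n 2) := by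
  intro X hX
  have h := ((isGogPair_of_mem hn hX).forwardStage (k := n) (by omega) le_rfl).1
  rw [sub_self, zero_add] at h
  rw [mem_gogamTrapezoids_iff hn, gogToGogam]
  exact ⟨h.congr (by omega) TwoDiag.agree_twoDiagOf_triangleOf.symm,
    TwoDiag.agree_twoDiagOf_triangleOf.triangleOf_eq⟩

theorem mapsTo_gogamToGog {n : ℕ} (hn : 2 ≤ n) :
    Set.MapsTo (gogamToGog n) (gogamTrapezoids n 2) (gogTrapezoids n 2) :=
  fun _ hX => (((mem_gogamTrapezoids_iff hn).1 hX).1.isGogPair hn).mem hn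

theorem invOn_gogamToGog {n : ℕ} (hn : 2 ≤ n) : Set.InvOn (gogamToGog n) (gogToGogam n)
    (gogTrapezoids n 2) (gogamTrapezoids n 2) := by
  refine ⟨fun X hX => ?_, fun Y hY => ?_⟩
  · have := (isGogPair_of_mem hn hX).agree_backwardStage (Y := gogToGogam n X) hn
      TwoDiag.agree_twoDiagOf_triangleOf
    rw [gogamToGog, this.triangleOf_eq, gogTrapezoid_eq_triangleOf hX]
  · obtain ⟨h1, h2⟩ := (mem_gogamTrapezoids_iff hn).1 hY
    have := h1.agree_forwardStage (X := gogamToGog n Y) hn TwoDiag.agree_twoDiagOf_triangleOf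
    rw [gogToGogam, this.triangleOf_eq, h2]

theorem bijOn_gogToGogam {n : ℕ} (hn : 2 ≤ n) :
    Set.BijOn (gogToGogam n) (gogTrapezoids n 2) (gogamTrapezoids n 2) :=
  (invOn_gogamToGog hn).bijOn (mapsTo_gogToGogam hn) (mapsTo_gogamToGog hn)

/-! ### Alternating sign matrices and Gog triangles -/

/-- Nonzero terms are jumps of a `0`-`1` function that is constant between consecutive jumps, so an
upward jump is followed by a downward one and vice versa. -/
theorem alternatesInSign_of_sub {n : ℕ} {f : Fin n → ℤ} {G : ℕ → ℤ}
    (hG : ∀ k, k ≤ n → G k = 0 ∨ G k = 1) (hf : ∀ q : Fin n, f q = G (q + 1) - G q) :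
    AlternatesInSign f := by
  intro p q hpq hp hq hr
  have hconst : ∀ k : ℕ, (p : ℕ) + 1 ≤ k → k ≤ q → G k = G (p + 1) := by
    intro k hk
    induction k, hk using Nat.le_induction with
    | base => exact fun _ => rfl
    | succ k hk ih =>
      intro hkq
      have := hr ⟨k, by omega⟩ (Fin.lt_def.2 (by simpa using hk)) (Fin.lt_def.2 (by simpa using hkq))
      rw [hf] at this
      simp only at this
      rw [← ih (by omega)]
      omega
  have h := hconst q hpq le_rfl
  rw [hf] at hp hq
  rw [hf, hf]
  have h1 := hG p (by omega)
  have h2 := hG (p + 1) (by omega)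
  have h3 := hG q (by omega)
  have h4 := hG (q + 1) (by omega)
  rcases h1 with h1 | h1 <;> rcases h2 with h2 | h2 <;> rcases h4 with h4 | h4 <;>
    simp_all

theorem sum_fin_sub {n m : ℕ} (hm : m ≤ n) (G : ℕ → ℤ) :
    ∑ q : Fin n, (if m ≤ (q : ℕ) then G (q + 1) - G q else 0) = G n - G m := by
  -- Truncating the argument of `G` at `m` kills the early terms, so the sum telescopes over the
  -- full range.
  have : ∀ q : Fin n, (if m ≤ (q : ℕ) then G (q + 1) - G q else 0) =
      (fun k => G (max (k + 1) m) - G (max k m)) q := by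
    intro q
    split_ifs with h
    · simp only
      rw [max_eq_left (by omega), max_eq_left h]
    · simp only
      rw [max_eq_right (by omega), max_eq_right (by omega), sub_self]
  rw [Finset.sum_congr rfl fun q _ => this q,
    Fin.sum_univ_eq_sum_range (fun k => G (max (k + 1) m) - G (max k m)) n,
    Finset.sum_range_sub (fun k => G (max k m)), max_eq_left hm, max_eq_right (Nat.zero_le m)]

/-- Sums of consecutive entries of an alternating sequence are at most one in absolute value. -/
theorem AlternatesInSign.abs_sum_le {n : ℕ} {f : Fin n → ℤ} (hf : AlternatesInSign f)
    (h1 : ∀ q, f q = -1 ∨ f q = 0 ∨ f q = 1) (a k : ℕ) (hk : k ≤ n) :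
    |∑ p : Fin n, (if a ≤ (p : ℕ) ∧ (p : ℕ) < k then f p else 0)| ≤ 1 := by
  -- Invariant: the partial sum is `0` or the last nonzero term, and the next nonzero term is the
  -- negative of that term.
  have main : ((∑ p : Fin n, (if a ≤ (p : ℕ) ∧ (p : ℕ) < k then f p else 0)) = 0 ∧
      ∀ p : Fin n, a ≤ (p : ℕ) → (p : ℕ) < k → f p = 0) ∨
      ∃ q : Fin n, a ≤ (q : ℕ) ∧ (q : ℕ) < k ∧ f q ≠ 0 ∧
        (∀ p : Fin n, q < p → (p : ℕ) < k → f p = 0) ∧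
        ((∑ p : Fin n, (if a ≤ (p : ℕ) ∧ (p : ℕ) < k then f p else 0)) = 0 ∨
          (∑ p : Fin n, (if a ≤ (p : ℕ) ∧ (p : ℕ) < k then f p else 0)) = f q) := by
    induction k with
    | zero => exact Or.inl ⟨by simp, fun p _ h => absurd h (Nat.not_lt_zero _)⟩
    | succ k ih =>
      have ih := ih (by omega)
      set x : Fin n := ⟨k, hk⟩ with hx
      have hsum : (∑ p : Fin n, (if a ≤ (p : ℕ) ∧ (p : ℕ) < k + 1 then f p else 0)) =
          (∑ p : Fin n, (if a ≤ (p : ℕ) ∧ (p : ℕ) < k then f p else 0)) +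
            if a ≤ k then f x else 0 := by
        have : ∀ p : Fin n, (if a ≤ (p : ℕ) ∧ (p : ℕ) < k + 1 then f p else 0) =
            (if a ≤ (p : ℕ) ∧ (p : ℕ) < k then f p else 0) +
              if x = p then (if a ≤ k then f x else 0) else 0 := by
          intro p
          by_cases hp : x = p
          · subst hp
            simp [hx]
          · have : (p : ℕ) ≠ k := fun h => hp (Fin.ext h.symm)
            rw [if_neg hp, add_zero]
            congr 1
            simp only [eq_iff_iff]
            omega
        rw [Finset.sum_congr rfl fun p _ => this p, Finset.sum_add_distrib]
        simp
      have hxk : ∀ p : Fin n, (p : ℕ) < k + 1 → (p : ℕ) < k ∨ p = x := fun p hp => by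
        rcases (Nat.lt_succ_iff.1 hp).lt_or_eq with h | h
        · exact Or.inl h
        · exact Or.inr (Fin.ext h)
      by_cases h0 : a ≤ k ∧ f x ≠ 0
      · rw [if_pos h0.1] at hsum
        refine Or.inr ⟨x, h0.1, Nat.lt_succ_self k, h0.2, fun p hp hpk => ?_, ?_⟩
        · have : k < (p : ℕ) := hp
          omega
        · rcases ih with ⟨ih, -⟩ | ⟨q, -, hqk, hq0, hqz, ih⟩
          · exact Or.inr (by rw [hsum, ih, zero_add])
          · have hneg := hf q x hqk hq0 h0.2 fun r hr hrx => hqz r hr hrx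
            have h2 := h1 q
            have h3 := h1 x
            have : f x = -f q := by
              rcases h2 with h2 | h2 | h2 <;> rcases h3 with h3 | h3 | h3 <;> simp_all
            rw [hsum]
            rcases ih with ih | ih <;> rw [ih, this] <;> simp
      · have hz : (if a ≤ k then f x else 0) = 0 := by
          split_ifs with h
          · by_contra h'
            exact h0 ⟨h, h'⟩
          · rfl
        rw [hz, add_zero] at hsum
        rw [hsum]
        rcases ih with ⟨ih, hq⟩ | ⟨q, hqa, hqk, hq0, hqz, ih⟩
        · refine Or.inl ⟨ih, fun p hpa hp => ?_⟩
          rcases hxk p hp with h | rfl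
          · exact hq p hpa h
          · by_contra h'
            exact h0 ⟨hpa, h'⟩
        · refine Or.inr ⟨q, hqa, by omega, hq0, fun p hqp hp => ?_, ih⟩
          rcases hxk p hp with h | rfl
          · exact hqz p hqp h
          · by_contra h'
            have : (q : ℕ) < k := hqk
            exact h0 ⟨by omega, h'⟩
  rcases main with ⟨h, -⟩ | ⟨q, -, -, -, -, h | h⟩
  · simp [h]
  · simp [h]
  · rw [h]
    rcases h1 q with h | h | h <;> simp [h]

/-- The suffix sums of an alternating sequence with sum one are `0` or `1`. -/
theorem AlternatesInSign.suffix_sum {n : ℕ} {f : Fin n → ℤ} (hf : AlternatesInSign f)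
    (h1 : ∀ q, f q = -1 ∨ f q = 0 ∨ f q = 1) (hs : ∑ q, f q = 1) (m : ℕ) (hm : m ≤ n) :
    (∑ p : Fin n, if m ≤ (p : ℕ) then f p else 0) = 0 ∨
      (∑ p : Fin n, if m ≤ (p : ℕ) then f p else 0) = 1 := by
  have a1 := hf.abs_sum_le h1 0 m hm
  have a2 := hf.abs_sum_le h1 m n le_rfl
  simp only [Fin.is_lt, and_true, Nat.zero_le, true_and] at a1 a2
  have : (∑ p : Fin n, if (p : ℕ) < m then f p else 0) +
      (∑ p : Fin n, if m ≤ (p : ℕ) then f p else 0) = 1 := by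
    rw [← hs, ← Finset.sum_add_distrib]
    refine Finset.sum_congr rfl fun p _ => ?_
    split_ifs <;> omega
  rw [abs_le] at a1 a2
  omega

/-- The sum of the last `i` entries of the column `q`. -/
def suffixSum {n : ℕ} (M : Matrix (Fin n) (Fin n) ℤ) (i : ℕ) (q : Fin n) : ℤ :=
  ∑ p : Fin n, (if n - i ≤ (p : ℕ) then M p q else 0)

theorem IsASM.suffixSum_eq {n : ℕ} {M : Matrix (Fin n) (Fin n) ℤ} (hM : IsASM M) (i : ℕ)
    (q : Fin n) : suffixSum M i q = 0 ∨ suffixSum M i q = 1 :=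
  (hM.col_alt q).suffix_sum (fun p => hM.entries p q) (hM.col_sum q) (n - i) (by omega)

theorem suffixSum_sub {n : ℕ} (M : Matrix (Fin n) (Fin n) ℤ) (p q : Fin n) :
    suffixSum M (n - p) q - suffixSum M (n - p - 1) q = M p q := by
  rw [suffixSum, suffixSum, ← Finset.sum_sub_distrib, Finset.sum_eq_single p]
  · rw [if_pos (by omega), if_neg (by omega), sub_zero]
  · intro r _ hr
    have : (r : ℕ) ≠ p := fun h => hr (Fin.ext h)
    split_ifs <;> omega
  · simp

/-- The suffix sums are `0` or `1`, so their total counts the ones; summed by rows it is `i`, each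
row contributing `1`. -/
theorem IsASM.card_one {n : ℕ} {M : Matrix (Fin n) (Fin n) ℤ} (hM : IsASM M) {i : ℕ} (hi : i ≤ n) :
    ∃ hf : (Set.ofPred (IsOneColumn M i)).Finite, hf.toFinset.card = i := by
  have hinj : Function.Injective fun q : Fin n => (q : ℕ) + 1 := fun a b h => by
    simpa [Fin.ext_iff] using h
  have hset : Set.ofPred (IsOneColumn M i) =
      ((Finset.univ.filter fun q => suffixSum M i q = 1).image fun q : Fin n => (q : ℕ) + 1) := by
    ext c
    simp only [Finset.coe_image, Set.mem_image, Finset.mem_coe]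
    exact ⟨fun ⟨q, h1, h2⟩ => ⟨q, (Finset.mem_filter_univ q).2 h2, h1⟩,
      fun ⟨q, h1, h2⟩ => ⟨q, h2, (Finset.mem_filter_univ q).1 h1⟩⟩
  have hf : (Set.ofPred (IsOneColumn M i)).Finite := hset ▸ Finset.finite_toSet _
  refine ⟨hf, ?_⟩
  have : hf.toFinset =
      (Finset.univ.filter fun q => suffixSum M i q = 1).image fun q : Fin n => (q : ℕ) + 1 := by
    apply Finset.coe_injective
    rw [hf.coe_toFinset, hset]
  rw [this, Finset.card_image_of_injective _ hinj]
  have h1 : ∑ q, suffixSum M i q = i := by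
    simp only [suffixSum]
    rw [Finset.sum_comm]
    have : ∀ p : Fin n, ∑ q, (if n - i ≤ (p : ℕ) then M p q else 0) =
        if n - i ≤ (p : ℕ) then (((p : ℕ) + 1 : ℕ) : ℤ) - (p : ℕ) else 0 := fun p => by
      split_ifs with h
      · rw [hM.row_sum p]
        push_cast
        ring
      · simp
    rw [Finset.sum_congr rfl fun p _ => this p, sum_fin_sub (by omega) fun k => (k : ℤ)]
    omega
  have h2 : ∀ q, suffixSum M i q = if suffixSum M i q = 1 then 1 else 0 := fun q => by
    rcases hM.suffixSum_eq i q with h | h <;> simp [h]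
  rw [Finset.sum_congr rfl fun q _ => h2 q, Finset.sum_boole] at h1
  exact_mod_cast h1

/-- The `i` entries of row `i` enumerate all one-columns by `card_one`. They determine the suffix
sums, and differences of suffix sums are the matrix entries. -/
theorem injOn_gogOfASM {n : ℕ} : Set.InjOn (gogOfASM n) {M | IsASM M} := by
  have key : ∀ M M' : Matrix (Fin n) (Fin n) ℤ, IsASM M → IsASM M' → gogOfASM n M = gogOfASM n M' →
      ∀ i, i ≤ n → ∀ c, IsOneColumn M i c → IsOneColumn M' i c := by
    intro M M' hM hM' h i hi c hc
    obtain ⟨hf, hcard⟩ := hM.card_one hi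
    obtain ⟨hf', hcard'⟩ := hM'.card_one hi
    obtain ⟨k, hk, rfl⟩ := Nat.exists_lt_card_finite_nth_eq hf hc
    rw [hcard] at hk
    have := congrFun (congrFun h i) (k + 1)
    simp only [gogOfASM, if_pos (show 1 ≤ k + 1 ∧ k + 1 ≤ i ∧ i ≤ n by omega),
      Nat.add_sub_cancel, Nat.cast_inj] at this
    rw [this]
    exact Nat.nth_mem_of_lt_card hf' (by rwa [hcard'])
  intro M hM M' hM' h
  have hone : ∀ (M : Matrix (Fin n) (Fin n) ℤ) (i : ℕ) (q : Fin n),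
      IsOneColumn M i ((q : ℕ) + 1) ↔ suffixSum M i q = 1 := by
    intro M i q
    refine ⟨fun ⟨r, hr, h⟩ => ?_, fun h => ⟨q, rfl, h⟩⟩
    obtain rfl : r = q := Fin.ext (by omega)
    exact h
  have hs : ∀ i, i ≤ n → ∀ q, suffixSum M i q = suffixSum M' i q := by
    intro i hi q
    have h1 := key M M' hM hM' h i hi ((q : ℕ) + 1)
    have h2 := key M' M hM' hM h.symm i hi ((q : ℕ) + 1)
    rw [hone, hone] at h1 h2
    rcases IsASM.suffixSum_eq hM i q with h | h <;> rcases IsASM.suffixSum_eq hM' i q with h' | h' <;>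
      simp_all
  ext p q
  rw [← suffixSum_sub M, ← suffixSum_sub M', hs _ (by omega), hs _ (by omega)]

/-! ### The alternating sign matrix of a Gog triangle -/

open scoped Classical in
/-- The indicator function of the entries of row `i` of a triangle. -/
noncomputable def rowIndicator (X : TriArray) (i : ℕ) (c : ℤ) : ℤ :=
  if ∃ j, 1 ≤ j ∧ j ≤ i ∧ X i j = c then 1 else 0

/-- The number of entries of row `i` of a triangle that are at most `c`. -/
def rowCount (X : TriArray) (i : ℕ) (c : ℤ) : ℕ :=
  ((Finset.Icc 1 i).filter fun j => X i j ≤ c).card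

/-- The matrix whose Gog triangle is `X`. -/
noncomputable def asmOfGog (n : ℕ) (X : TriArray) : Matrix (Fin n) (Fin n) ℤ := fun p q =>
  rowIndicator X (n - p) ((q : ℕ) + 1) - rowIndicator X (n - p - 1) ((q : ℕ) + 1)

namespace IsGog

variable {n : ℕ} {X : TriArray}

theorem strictMono (hX : IsGog n X) {i j j' : ℕ} (hi : i ≤ n) (h1 : 1 ≤ j) (hj : j < j')
    (hj' : j' ≤ i) : X i j < X i j' := by
  induction j', (show j + 1 ≤ j' from hj) using Nat.le_induction with
  | base =>
    rcases hi.lt_or_eq with hi | rfl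
    · exact hX.strict i j h1 (by omega) (by omega)
    · rw [hX.top j h1 (by omega), hX.top (j + 1) (by omega) hj']
      simp
  | succ j' hjj ih =>
    refine (ih (by omega) (by omega)).trans ?_
    rcases hi.lt_or_eq with hi | rfl
    · exact hX.strict i j' (by omega) (by omega) (by omega)
    · rw [hX.top j' (by omega) (by omega), hX.top (j' + 1) (by omega) hj']
      simp

theorem le_size (hX : IsGog n X) {i j : ℕ} (h1 : 1 ≤ j) (hj : j ≤ i) (hi : i ≤ n) : X i j ≤ n := by
  obtain ⟨m, hm⟩ := Nat.exists_eq_add_of_le hi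
  induction m generalizing i j with
  | zero =>
    obtain rfl : n = i := hm
    rw [hX.top j h1 hj]
    exact_mod_cast hj
  | succ m ih =>
    exact (hX.gt.right i j h1 hj (by omega)).trans (ih (by omega) (by omega) (by omega) (by omega))

theorem rowCount_succ (hX : IsGog n X) {i : ℕ} (hi : i ≤ n) (c : ℤ) :
    (rowCount X i (c + 1) : ℤ) - rowCount X i c = rowIndicator X i (c + 1) := by
  have hsplit : (Finset.Icc 1 i).filter (fun j => X i j ≤ c + 1) =
      (Finset.Icc 1 i).filter (fun j => X i j ≤ c) ∪
        (Finset.Icc 1 i).filter fun j => X i j = c + 1 := by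
    rw [← Finset.filter_or]
    refine Finset.filter_congr fun j _ => ?_
    omega
  have hdisj : Disjoint ((Finset.Icc 1 i).filter fun j => X i j ≤ c)
      ((Finset.Icc 1 i).filter fun j => X i j = c + 1) := by
    refine Finset.disjoint_filter.2 fun j _ h => ?_
    omega
  rw [rowCount, rowCount, hsplit, Finset.card_union_of_disjoint hdisj, rowIndicator]
  push_cast
  rw [add_sub_cancel_left]
  split_ifs with h
  · obtain ⟨j, h1, hj, hc⟩ := h
    have : (Finset.Icc 1 i).filter (fun j => X i j = c + 1) = {j} := by
      ext j'
      simp only [Finset.mem_filter, Finset.mem_Icc, Finset.mem_singleton]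
      refine ⟨fun ⟨⟨h1', hj'⟩, hc'⟩ => ?_, ?_⟩
      · rcases lt_trichotomy j j' with h | h | h
        · have := hX.strictMono hi h1 h hj'
          omega
        · exact h.symm
        · have := hX.strictMono hi h1' h hj
          omega
      · rintro rfl
        exact ⟨⟨h1, hj⟩, hc⟩
    rw [this, Finset.card_singleton, Nat.cast_one]
  · rw [Finset.filter_false_of_mem, Finset.card_empty, Nat.cast_zero]
    intro j hj hc
    rw [Finset.mem_Icc] at hj
    exact h ⟨j, hj.1, hj.2, hc⟩

/-- The two interlacing inequalities give the two bounds: `left` keeps the index, and `right` shifts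
it by one, missing only the first entry. -/
theorem rowCount_sub (hX : IsGog n X) {i : ℕ} (h1 : 1 ≤ i) (hi : i ≤ n) (c : ℤ) :
    (rowCount X i c : ℤ) - rowCount X (i - 1) c = 0 ∨
      (rowCount X i c : ℤ) - rowCount X (i - 1) c = 1 := by
  obtain ⟨i, rfl⟩ := Nat.exists_eq_add_of_le' h1
  rw [Nat.add_sub_cancel]
  have hle : rowCount X i c ≤ rowCount X (i + 1) c := by
    refine Finset.card_le_card fun j hj => ?_
    simp only [Finset.mem_filter, Finset.mem_Icc] at hj ⊢
    have := hX.gt.left i j hj.1.1 hj.1.2 hi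
    exact ⟨⟨hj.1.1, by omega⟩, by omega⟩
  have hge : rowCount X (i + 1) c ≤ rowCount X i c + 1 := by
    have hsub : (Finset.Icc 1 (i + 1)).filter (fun j => X (i + 1) j ≤ c) ⊆
        insert 1 (((Finset.Icc 1 i).filter fun j => X i j ≤ c).image (· + 1)) := by
      intro j hj
      simp only [Finset.mem_filter, Finset.mem_Icc, Finset.mem_insert, Finset.mem_image] at hj ⊢
      rcases hj.1.1.lt_or_eq with h | h
      · refine Or.inr ⟨j - 1, ⟨⟨by omega, by omega⟩, ?_⟩, by omega⟩
        have := hX.gt.right i (j - 1) (by omega) (by omega) hi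
        rw [Nat.sub_add_cancel hj.1.1] at this
        omega
      · exact Or.inl h.symm
    exact (Finset.card_le_card hsub).trans ((Finset.card_insert_le _ _).trans
      (Nat.add_le_add_right Finset.card_image_le 1))
  omega

theorem rowCount_zero (hX : IsGog n X) {i : ℕ} (hi : i ≤ n) : rowCount X i 0 = 0 := by
  rw [rowCount, Finset.filter_false_of_mem, Finset.card_empty]
  intro j hj h
  rw [Finset.mem_Icc] at hj
  have := hX.gt.pos i j hj.1 hj.2 hi
  omega

theorem rowCount_size (hX : IsGog n X) {i : ℕ} (hi : i ≤ n) : rowCount X i n = i := by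
  rw [rowCount, Finset.filter_true_of_mem, Nat.card_Icc, Nat.add_sub_cancel]
  intro j hj
  rw [Finset.mem_Icc] at hj
  exact hX.le_size hj.1 hj.2 hi

/-- Rows and columns are both differences of `0`-`1` functions: along a row, of the difference of
counts in consecutive rows of `X`; down a column, of one minus the row indicator. -/
theorem isASM (hX : IsGog n X) : IsASM (asmOfGog n X) := by
  have hind : ∀ i c, rowIndicator X i c = 0 ∨ rowIndicator X i c = 1 := fun i c => by
    rw [rowIndicator]
    split_ifs <;> simp
  have hrow : ∀ p q : Fin n, asmOfGog n X p q =
      (fun k : ℕ => (rowCount X (n - p) k : ℤ) - rowCount X (n - p - 1) k) (q + 1) -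
        (fun k : ℕ => (rowCount X (n - p) k : ℤ) - rowCount X (n - p - 1) k) q := fun p q => by
    rw [asmOfGog, ← hX.rowCount_succ (by omega), ← hX.rowCount_succ (by omega)]
    push_cast
    ring
  have hcol : ∀ q p : Fin n, asmOfGog n X p q =
      (fun k : ℕ => 1 - rowIndicator X (n - k) ((q : ℕ) + 1)) (p + 1) -
        (fun k : ℕ => 1 - rowIndicator X (n - k) ((q : ℕ) + 1)) p := fun q p => by
    rw [asmOfGog]
    simp only [Nat.sub_sub]
    ring
  have hsum : ∀ G : ℕ → ℤ, ∑ q : Fin n, (G (q + 1) - G q) = G n - G 0 := fun G => by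
    simpa using sum_fin_sub (Nat.zero_le n) G
  have h0 : ∀ c, rowIndicator X 0 c = 0 := fun c => by
    rw [rowIndicator, if_neg]
    rintro ⟨j, h1, h2, -⟩
    omega
  constructor
  · intro p q
    have h1 := hind (n - p) ((q : ℕ) + 1)
    have h2 := hind (n - p - 1) ((q : ℕ) + 1)
    rw [asmOfGog]
    omega
  · intro p
    rw [Finset.sum_congr rfl fun q _ => hrow p q,
      hsum (fun k : ℕ => (rowCount X (n - p) k : ℤ) - rowCount X (n - p - 1) k)]
    simp only [Nat.cast_zero]
    rw [hX.rowCount_zero (by omega), hX.rowCount_zero (by omega), hX.rowCount_size (by omega),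
      hX.rowCount_size (by omega)]
    omega
  · intro q
    rw [Finset.sum_congr rfl fun p _ => hcol q p,
      hsum (fun k : ℕ => 1 - rowIndicator X (n - k) ((q : ℕ) + 1))]
    simp only [Nat.sub_self, Nat.sub_zero]
    rw [h0, rowIndicator, if_pos]
    · simp
    · refine ⟨q + 1, by omega, by omega, ?_⟩
      rw [hX.top _ (by omega) (by omega)]
      push_cast
      rfl
  · intro p
    exact alternatesInSign_of_sub (fun k _ => hX.rowCount_sub (by omega) (by omega) k) (hrow p)
  · intro q
    refine alternatesInSign_of_sub (G := fun k : ℕ => 1 - rowIndicator X (n - k) ((q : ℕ) + 1))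
      (fun k _ => ?_) (hcol q)
    have := hind (n - k) ((q : ℕ) + 1)
    omega

theorem isOneColumn_asmOfGog (hX : IsGog n X) {i c : ℕ} (hi : i ≤ n) :
    IsOneColumn (asmOfGog n X) i c ↔ ∃ j, 1 ≤ j ∧ j ≤ i ∧ X i j = c := by
  have hs : ∀ q : Fin n, (∑ p : Fin n, if n - i ≤ (p : ℕ) then asmOfGog n X p q else 0) =
      rowIndicator X i ((q : ℕ) + 1) := fun q => by
    have := sum_fin_sub (n := n) (m := n - i) (by omega)
      (fun k : ℕ => - rowIndicator X (n - k) ((q : ℕ) + 1))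
    simp only [Nat.sub_self, Nat.sub_sub_self hi] at this
    have h0 : rowIndicator X 0 ((q : ℕ) + 1) = 0 := by
      rw [rowIndicator, if_neg]
      rintro ⟨j, h1, h2, -⟩
      omega
    rw [h0, neg_zero, zero_sub, neg_neg] at this
    rw [← this]
    refine Finset.sum_congr rfl fun p _ => ?_
    congr 1
    rw [asmOfGog, Nat.sub_sub]
    ring
  rw [IsOneColumn]
  simp only [hs, rowIndicator]
  constructor
  · rintro ⟨q, rfl, h⟩
    split_ifs at h with h'
    · push_cast
      exact h'
    · exact absurd h zero_ne_one
  · rintro ⟨j, h1, hj, hc⟩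
    have hpos := hX.gt.pos i j h1 hj hi
    have hle := hX.le_size h1 hj hi
    refine ⟨⟨c - 1, by omega⟩, by simp only; omega, if_pos ⟨j, h1, hj, ?_⟩⟩
    rw [hc, Nat.cast_sub (by omega)]
    simp

theorem gogOfASM_asmOfGog (hX : IsGog n X) : gogOfASM n (asmOfGog n X) = X := by
  classical
  funext i j
  rw [gogOfASM]
  split_ifs with h
  · obtain ⟨h1, hj, hi⟩ := h
    have hpos : ∀ j, 1 ≤ j → j ≤ i → ((X i j).toNat : ℤ) = X i j := fun j h1 hj =>
      Int.toNat_of_nonneg (hX.gt.pos i j h1 hj hi).le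
    have hone : IsOneColumn (asmOfGog n X) i (X i j).toNat :=
      (hX.isOneColumn_asmOfGog hi).2 ⟨j, h1, hj, (hpos j h1 hj).symm⟩
    -- By strictness of row `i`, the one-columns below `X i j` are exactly its first `j - 1`
    -- entries, so `Nat.nth` at `j - 1` returns `X i j`.
    have hcount : Nat.count (IsOneColumn (asmOfGog n X) i) (X i j).toNat = j - 1 := by
      have : (Finset.range (X i j).toNat).filter (IsOneColumn (asmOfGog n X) i) =
          (Finset.Icc 1 (j - 1)).image fun k => (X i k).toNat := by
        ext c
        simp only [Finset.mem_filter, Finset.mem_range, Finset.mem_image, Finset.mem_Icc,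
          hX.isOneColumn_asmOfGog hi]
        constructor
        · rintro ⟨hc, k, hk1, hki, hk⟩
          refine ⟨k, ⟨hk1, ?_⟩, by omega⟩
          by_contra hkj
          rcases (show j ≤ k by omega).lt_or_eq with h | rfl
          · have := hX.strictMono hi h1 h hki
            omega
          · omega
        · rintro ⟨k, ⟨hk1, hkj⟩, rfl⟩
          have := hX.strictMono hi hk1 (show k < j by omega) hj
          have := hpos k hk1 (by omega)
          exact ⟨by omega, k, hk1, by omega, this.symm⟩
      rw [Nat.count_eq_card_filter_range, this, Finset.card_image_of_injOn, Nat.card_Icc,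
        Nat.add_sub_cancel]
      intro a ha b hb hab
      simp only [Finset.coe_Icc, Set.mem_Icc] at ha hb hab
      have e1 := hpos a ha.1 (by omega)
      have e2 := hpos b hb.1 (by omega)
      rcases lt_trichotomy a b with h | h | h
      · have := hX.strictMono hi ha.1 h (by omega)
        omega
      · exact h
      · have := hX.strictMono hi hb.1 h (by omega)
        omega
    rw [← hcount, Nat.nth_count hone, hpos j h1 hj]
  · exact (hX.gt.zero i j h).symm

end IsGog

theorem bijOn_gogOfASM (n k : ℕ) :
    Set.BijOn (gogOfASM n) (asmTrapezoids n k) (gogTrapezoids n k) := by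
  refine ⟨fun M hM => hM.2, injOn_gogOfASM.mono fun M hM => hM.1, fun X hX => ?_⟩
  have h := hX.1.gogOfASM_asmOfGog
  exact ⟨asmOfGog n X, ⟨hX.1.isASM, by rwa [h]⟩, h⟩

theorem mainTheorem1 (n : ℕ) (hn : 2 ≤ n) :
    -- every step of the algorithm and of the inverse algorithm yields an admissible triangle
    (∀ X ∈ gogTrapezoids n 2, ∀ k, 1 ≤ k → k ≤ n →
      IsAdmissible n k (forwardStage n X k) ∧
        (forwardStage n X k).u (k - 1) = X (n - (k - 1)) (n - (k - 1))) ∧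
    (∀ X ∈ gogamTrapezoids n 2, ∀ k, 1 ≤ k → k ≤ n →
      IsAdmissible n k (backwardStage n X (n - k))) ∧
    -- the two maps are well defined and inverse to each other
    Set.MapsTo (gogToGogam n) (gogTrapezoids n 2) (gogamTrapezoids n 2) ∧
    Set.MapsTo (gogamToGog n) (gogamTrapezoids n 2) (gogTrapezoids n 2) ∧
    Set.InvOn (gogamToGog n) (gogToGogam n) (gogTrapezoids n 2) (gogamTrapezoids n 2) ∧
    Set.BijOn (gogToGogam n) (gogTrapezoids n 2) (gogamTrapezoids n 2) ∧
    -- composition with the involution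
    Set.BijOn (schutzenberger n ∘ gogToGogam n) (gogTrapezoids n 2) (magogTrapezoids n 2) ∧
    -- the same in terms of alternating sign matrices
    Set.BijOn (gogToGogam n ∘ gogOfASM n) (asmTrapezoids n 2) (gogamTrapezoids n 2) ∧
    Set.BijOn (schutzenberger n ∘ gogToGogam n ∘ gogOfASM n)
      (asmTrapezoids n 2) (magogTrapezoids n 2) := by
  have hΦ := bijOn_gogToGogam hn
  have hS := bijOn_schutzenberger (n := n) (k := 2) (by omega)
  have hG := bijOn_gogOfASM n 2
  refine ⟨fun X hX k hk hkn => ?_, fun X hX k hk hkn => ?_, mapsTo_gogToGogam hn,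
    mapsTo_gogamToGog hn, invOn_gogamToGog hn, hΦ, hS.comp hΦ, hΦ.comp hG, hS.comp (hΦ.comp hG)⟩
  · have h := (isGogPair_of_mem hn hX).forwardStage hk hkn
    exact ⟨h.1.isAdmissible hk hkn, h.2.1⟩
  · exact ((((mem_gogamTrapezoids_iff hn).1 hX).1.backwardStage hk hkn).1).isAdmissible hk hkn
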